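/- **Setting.** Let $d\ge 1$, let $\mathcal X\subset\mathbf R^d$ be convex and compact, and let $\Theta\subset\mathbf R^q$ be compact and such that, for some constants $c,\delta>0$, any two points $a,b\in\Theta$ with $|a-b|\le\delta$ can be joined inside $\Theta$ by a curve of length at most $c|a-b|$ (for instance, $\Theta$ convex). Let $\Phi$ be a kernel on $\mathcal X\times\mathcal X$ that is conditionally positive definite with respect to a finite-dimensional space $\mathcal P$ of functions on $\mathcal X$. Its native space $\mathcal N$ consists of the functions $f$ on $\mathcal X$ for which there is a constant $C\ge 0$ with $$\Big|\sum_k a_k f(s_k)\Big|\le C\Big(\sum_{k,l}a_ka_l\Phi(s_k,s_l)\Big)^{1/2}$$ for all finite sums with $\sum_k a_kp(s_k)=0$ for every $p\in\mathcal P$; the native semi-norm $\|f\|_{\mathcal N}$ is the least such $C$. For $\boldsymbol f=(f_1,\dots,f_q)$ let $\|\boldsymbol f\|_{\mathcal N}=(\sum_j\|f_j\|_{\mathcal N}^2)^{1/2}$ and $\|\boldsymbol f\|_{L_2(\mathcal X)}=(\sum_j\|f_j\|^2_{L_2(\mathcal X)})^{1/2}$, and let $\mathcal N^\Theta$ be the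 set of $\boldsymbol f=(f_1,\dots,f_q)$ with all $f_j\in\mathcal N$ and $\boldsymbol f(x)\in\Theta$ for all $x\in\mathcal X$. Let $\zeta:\mathcal X\to\mathbf R^r$ be a bounded function (the physical response), let $y^s$ (the computer model) and $\hat y^s_n$, $n\ge1$ (the emulators), be functions from $\mathcal X\times\Theta$ to $\mathbf R^r$, and fix $\nu>d/2$. **Assumptions.** 1′. For each $n\ge 1$ the design points $x_1,\dots,x_n\in\mathcal X$ (which may depend on $n$) are deterministic and, with $\|f\|_n=(n^{-1}\sum_{i=1}^n f(x_i)^2)^{1/2}$, $$\|f\|_{L_2(\mathcal X)}\le C_0\big(\|f\|_n+n^{-\nu/(2\nu+d)}\|f\|_{\mathcal N}\big)\quad\text{for all } f\in\mathcal N,$$ with $C_0$ independent of $n$ and $f$. One observes $y_i^p=\zeta(x_i)+e_i$, $i=1,\dots,n$, where the random vectors $e_1,\dots,e_n$ are independent with mean zero and sub-Gaussian with a common parameter $\sigma>0$, i.e. $E\exp(\alpha^Te_i)\le\exp(\sigma^2|\alpha|^2/2)$ for all $\alpha\in\mathbf R^r$. 2. $y^s\in C^2(\mathcal X\times\Theta)$.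 3. There is $C>0$ such that, for all $\epsilon,\rho>0$, the $\epsilon$-covering number of $\{f\in\mathcal N:\|f\|_{\mathcal N}\le\rho\}$ in the supremum norm satisfies $\log N\le(C\rho/\epsilon)^{d/\nu}$. 4. The $\hat y^s_n$ are $C^1$ on $\mathcal X\times\Theta$, and $\|\hat y^s_n-y^s\|_{C^1(\mathcal X\times\Theta)}=O(n^{-\nu/(2\nu+d)})$, where the $C^1$ norm is the supremum of the absolute values of all components and of all their first-order partial derivatives. 5. The optimal calibration function $\theta^*\in\mathcal N^\Theta$ exists: $\theta^*(x)$ minimizes $|\zeta(x)-y^s(x,\cdot)|^2$ over $\Theta$ for every $x\in\mathcal X$, and for some $\omega_0>0$, $$|\zeta(x)-y^s(x,\theta)|^2-|\zeta(x)-y^s(x,\theta^*(x))|^2\ge\omega_0|\theta-\theta^*(x)|^2\quad\text{for all }\theta\in\Theta,\ x\in\mathcal X.$$ 6. $\lambda_n>0$ is a deterministic sequence with $\lambda_n=O(n^{-2\nu/(2\nu+d)})$ and $\lambda_n^{-1}=O(n^{2\nu/(2\nu+d)})$. **Conclusion.** Let $\hat\theta_n$ be, almost surely, a minimizer over $\theta\in\mathcal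 N^\Theta$ of $$\frac1n\sum_{i=1}^n\big|y_i^p-\hat y^s_n(x_i,\theta(x_i))\big|^2+\lambda_n\sum_{j=1}^q\|\theta_j\|_{\mathcal N}^2 .$$ Then $$\|\hat\theta_n-\theta^*\|_{L_2(\mathcal X)}=O_p\big(n^{-\nu/(2\nu+d)}\big)\qquad\text{and}\qquad\|\hat\theta_n\|_{\mathcal N}=O_p(1).$$ -/

import Mathlib

open MeasureTheory ProbabilityTheory Filter
open scoped ENNReal

namespace FunCalib

noncomputable section

/-! ## Native spaces of conditionally positive definite kernels -/

/-- The value `∑ a_s f(s)` on `f` of the finitely supported functional `∑ a_s δ_s`. -/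
def pairing {S : Type*} (c : S →₀ ℝ) (f : S → ℝ) : ℝ :=
  c.sum fun s a => a * f s

/-- The quadratic form `∑ a_s a_t Φ(s,t)` of the kernel `Φ` at `∑ a_s δ_s`. -/
def quadForm {S : Type*} (Φ : S → S → ℝ) (c : S →₀ ℝ) : ℝ :=
  c.sum fun s a => c.sum fun t b => a * b * Φ s t

/-- The functional `∑ a_s δ_s` vanishes on every function in `P`. -/
def Annihilates {S : Type*} (P : Submodule ℝ (S → ℝ)) (c : S →₀ ℝ) : Prop :=
  ∀ p ∈ P, pairing c p = 0

/-- `Φ` is a symmetric kernel, conditionally positive definite with respect to the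
finite-dimensional function space `P`. The inequality is not required to be strict, so that
strictly conditionally positive definite kernels are a special case; `P = ⊥` gives the
(unconditionally) positive definite kernels. -/
structure IsCondPosDef {S : Type*} (Φ : S → S → ℝ) (P : Submodule ℝ (S → ℝ)) : Prop where
  finiteDimensional : FiniteDimensional ℝ P
  symm : ∀ s t, Φ s t = Φ t s
  nonneg : ∀ c : S →₀ ℝ, Annihilates P c → 0 ≤ quadForm Φ c

/-- `|c(f)| ≤ C ‖c‖_Φ` for all finitely supported functionals `c` vanishing on `P`, where
`‖c‖_Φ` is the square root of the quadratic form of `Φ` at `c`. -/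
def NativeBound {S : Type*} (Φ : S → S → ℝ) (P : Submodule ℝ (S → ℝ)) (f : S → ℝ)
    (C : ℝ) : Prop :=
  0 ≤ C ∧ ∀ c : S →₀ ℝ, Annihilates P c → |pairing c f| ≤ C * Real.sqrt (quadForm Φ c)

/-- The native space of `Φ` (with respect to `P`): the functions on which all functionals
vanishing on `P` are bounded with respect to `‖·‖_Φ`. For `P = ⊥` this is the reproducing
kernel Hilbert space of `Φ`. -/
def nativeSpace {S : Type*} (Φ : S → S → ℝ) (P : Submodule ℝ (S → ℝ)) : Set (S → ℝ) :=
  {f | ∃ C, NativeBound Φ P f C}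

/-- The native semi-norm: the least constant `C` with `|c(f)| ≤ C ‖c‖_Φ`. It is only used for
members of the native space. -/
def nativeNorm {S : Type*} (Φ : S → S → ℝ) (P : Submodule ℝ (S → ℝ)) (f : S → ℝ) : ℝ :=
  sInf {C | NativeBound Φ P f C}

/-- The ball `{f ∈ 𝒩 : ‖f‖_𝒩 ≤ ρ}`. -/
def nativeBall {S : Type*} (Φ : S → S → ℝ) (P : Submodule ℝ (S → ℝ)) (ρ : ℝ) :
    Set (S → ℝ) :=
  {f | f ∈ nativeSpace Φ P ∧ nativeNorm Φ P f ≤ ρ}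

/-- The Euclidean norm of `(‖f_1‖_𝒩, …, ‖f_q‖_𝒩)`, for a vector-valued function. -/
def nativeNormVec {S : Type*} {q : ℕ} (Φ : S → S → ℝ) (P : Submodule ℝ (S → ℝ))
    (f : S → EuclideanSpace ℝ (Fin q)) : ℝ :=
  Real.sqrt (∑ j, nativeNorm Φ P (fun s => f s j) ^ 2)

/-- The set `𝒩^Θ` of vector-valued functions with components in the native space and values
in `Θ`. -/
def nativeSpaceIn {S : Type*} {q : ℕ} (Φ : S → S → ℝ) (P : Submodule ℝ (S → ℝ))
    (Θ : Set (EuclideanSpace ℝ (Fin q))) : Set (S → EuclideanSpace ℝ (Fin q)) :=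
  {f | (∀ j, (fun s => f s j) ∈ nativeSpace Φ P) ∧ ∀ s, f s ∈ Θ}

/-! ## Covering numbers in the supremum norm -/

/-- `A` is covered by `N` closed balls of radius `δ` for the supremum norm. -/
def CoveredBy {S : Type*} (δ : ℝ) (A : Set (S → ℝ)) (N : ℕ) : Prop :=
  ∃ g : Fin N → S → ℝ, ∀ f ∈ A, ∃ j, ∀ s, |f s - g j s| ≤ δ

/-- The covering number of `A` for the supremum norm (`⊤` if there is no finite cover). -/
def coveringNumber {S : Type*} (δ : ℝ) (A : Set (S → ℝ)) : ℕ∞ :=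
  ⨅ (N : ℕ) (_ : CoveredBy δ A N), (N : ℕ∞)

/-! ## Norms -/

/-- The empirical semi-norm `(n⁻¹ ∑ f(x_i)²)^{1/2}` of a design `x_1, …, x_n`. -/
def empNorm {S : Type*} {n : ℕ} (x : Fin n → S) (f : S → ℝ) : ℝ :=
  Real.sqrt ((∑ i, f (x i) ^ 2) / n)

/-- The `L₂` norm of a function on `X ⊆ ℝ^d` for Lebesgue measure, with values in `[0,∞]`. -/
def l2Norm {d : ℕ} {X : Set (EuclideanSpace ℝ (Fin d))} (f : X → ℝ) : ℝ≥0∞ :=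
  (∫⁻ x : X, ‖f x‖ₑ ^ 2 ∂(volume.comap (Subtype.val : X → EuclideanSpace ℝ (Fin d)))) ^
    (1 / 2 : ℝ)

/-- The `L₂` norm `(∑ ‖f_j‖²)^{1/2}` of a vector-valued function. -/
def l2NormVec {d q : ℕ} {X : Set (EuclideanSpace ℝ (Fin d))}
    (f : X → EuclideanSpace ℝ (Fin q)) : ℝ≥0∞ :=
  (∑ j, l2Norm (fun x => f x j) ^ 2) ^ (1 / 2 : ℝ)

/-- The `C¹` norm on `Γ ⊆ ℝ^d × ℝ^q`: the supremum over `Γ` of the absolute values of the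
components of `g` and of their first order partial derivatives (taken within `Γ`). -/
def c1Norm {d q r : ℕ} (Γ : Set (EuclideanSpace ℝ (Fin d) × EuclideanSpace ℝ (Fin q)))
    (g : EuclideanSpace ℝ (Fin d) × EuclideanSpace ℝ (Fin q) → EuclideanSpace ℝ (Fin r)) :
    ℝ≥0∞ :=
  ⨆ p ∈ Γ, ⨆ k : Fin r,
    max ‖g p k‖ₑ
      (max (⨆ j : Fin d, ‖fderivWithin ℝ g Γ p (EuclideanSpace.single j 1, 0) k‖ₑ)
        (⨆ j : Fin q, ‖fderivWithin ℝ g Γ p (0, EuclideanSpace.single j 1) k‖ₑ))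

/-! ## Geometry of the parameter set -/

/-- Any two sufficiently close points `a, b` of `Θ` are joined inside `Θ` by a rectifiable
curve of length at most `c |a - b|`. Every convex set has this property (with segments). -/
def LocallyQuasiconvex {q : ℕ} (Θ : Set (EuclideanSpace ℝ (Fin q))) : Prop :=
  ∃ c δ : ℝ, 0 < δ ∧ ∀ a ∈ Θ, ∀ b ∈ Θ, dist a b ≤ δ →
    ∃ γ : ℝ → EuclideanSpace ℝ (Fin q), γ 0 = a ∧ γ 1 = b ∧
      (∀ t ∈ Set.Icc (0 : ℝ) 1, γ t ∈ Θ) ∧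
      ∀ s ∈ Set.Icc (0 : ℝ) 1, ∀ t ∈ Set.Icc (0 : ℝ) 1,
        dist (γ s) (γ t) ≤ c * dist a b * |s - t|

/-! ## Probability -/

/-- The random vector `ξ` is sub-Gaussian with parameter `σ`. -/
structure IsSubGaussian {Ω : Type*} [MeasurableSpace Ω] {r : ℕ}
    (ξ : Ω → EuclideanSpace ℝ (Fin r)) (σ : ℝ) (μ : Measure Ω) : Prop where
  integrable : Integrable ξ μ
  integrable_exp : ∀ α : EuclideanSpace ℝ (Fin r),
    Integrable (fun ω => Real.exp (inner ℝ α (ξ ω - ∫ ω', ξ ω' ∂μ))) μ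
  bound : ∀ α : EuclideanSpace ℝ (Fin r),
    ∫ ω, Real.exp (inner ℝ α (ξ ω - ∫ ω', ξ ω' ∂μ)) ∂μ ≤ Real.exp (σ ^ 2 * ‖α‖ ^ 2 / 2)

/-- `Z_n = O_p(a_n)`. The sets need not be measurable: `μ` is then the outer measure. -/
def IsBigOp {Ω : Type*} [MeasurableSpace Ω] (μ : Measure Ω) (Z : ℕ → Ω → ℝ≥0∞)
    (a : ℕ → ℝ) : Prop :=
  ∀ ε : ℝ, 0 < ε → ∃ C : ℝ, 0 < C ∧
    ∀ᶠ n in atTop, μ {ω | ENNReal.ofReal (C * a n) < Z n ω} ≤ ENNReal.ofReal ε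

/-! ## The conditions and the estimator -/

/-- Deterministic designs `x_{n,1}, …, x_{n,n}` with
`‖f‖_{L₂} ≲ ‖f‖_n + n^{-ν/(2ν+d)} ‖f‖_𝒩` uniformly in `f ∈ 𝒩` and `n ≥ 1`. -/
def DesignCondition {d : ℕ} {X : Set (EuclideanSpace ℝ (Fin d))} (Φ : X → X → ℝ)
    (P : Submodule ℝ (X → ℝ)) (ν : ℝ) (x : (n : ℕ) → Fin n → X) : Prop :=
  ∃ C : ℝ, ∀ n : ℕ, 1 ≤ n → ∀ f ∈ nativeSpace Φ P,
    l2Norm f ≤ ENNReal.ofReal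
      (C * (empNorm (x n) f + (n : ℝ) ^ (-(ν / (2 * ν + d))) * nativeNorm Φ P f))

/-- For each `n` the noise vectors `e_{n,1}, …, e_{n,n}` are independent, with mean zero, and
sub-Gaussian with the common parameter `σ`. -/
structure NoiseCondition {Ω : Type*} [MeasurableSpace Ω] {r : ℕ} (μ : Measure Ω) (σ : ℝ)
    (e : (n : ℕ) → Fin n → Ω → EuclideanSpace ℝ (Fin r)) : Prop where
  measurable : ∀ n i, Measurable (e n i)
  indep : ∀ n, iIndepFun (e n) μ
  mean_zero : ∀ n i, ∫ ω, e n i ω ∂μ = 0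
  subGaussian : ∀ n i, IsSubGaussian (e n i) σ μ

/-- The entropy bound `log N(ε, {f ∈ 𝒩 : ‖f‖_𝒩 ≤ ρ}, L_∞) ≤ (Cρ/ε)^{d/ν}`. -/
def EntropyCondition {S : Type*} (Φ : S → S → ℝ) (P : Submodule ℝ (S → ℝ)) (d : ℕ)
    (ν : ℝ) : Prop :=
  ∃ C : ℝ, 0 < C ∧ ∀ ε ρ : ℝ, 0 < ε → 0 < ρ →
    ∃ N : ℕ, coveringNumber ε (nativeBall Φ P ρ) = N ∧
      Real.log N ≤ (C * ρ / ε) ^ ((d : ℝ) / ν)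

/-- The emulators are `C¹` on `Γ` and `‖ŷ_n - y‖_{C¹(Γ)} = O(n^{-ν/(2ν+d)})`. -/
def EmulatorCondition {d q r : ℕ}
    (Γ : Set (EuclideanSpace ℝ (Fin d) × EuclideanSpace ℝ (Fin q))) (ν : ℝ)
    (y : EuclideanSpace ℝ (Fin d) × EuclideanSpace ℝ (Fin q) → EuclideanSpace ℝ (Fin r))
    (yhat : ℕ → EuclideanSpace ℝ (Fin d) × EuclideanSpace ℝ (Fin q) →
      EuclideanSpace ℝ (Fin r)) : Prop :=
  (∀ n, ContDiffOn ℝ 1 (yhat n) Γ) ∧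
  ∃ C : ℝ, ∀ᶠ n : ℕ in atTop,
    c1Norm Γ (fun p => yhat n p - y p) ≤
      ENNReal.ofReal (C * (n : ℝ) ^ (-(ν / (2 * ν + d))))

/-- `θ*` is the optimal calibration function: `θ*(x)` minimizes `|ζ(x) - y(x,·)|²` over `Θ` for
every `x`, and it does so with a quadratic margin that is uniform in `x`. -/
def IdentifiabilityCondition {d q r : ℕ} {X : Set (EuclideanSpace ℝ (Fin d))}
    (Θ : Set (EuclideanSpace ℝ (Fin q))) (ζ : X → EuclideanSpace ℝ (Fin r))
    (y : EuclideanSpace ℝ (Fin d) × EuclideanSpace ℝ (Fin q) → EuclideanSpace ℝ (Fin r))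
    (θstar : X → EuclideanSpace ℝ (Fin q)) : Prop :=
  (∀ x : X, θstar x ∈ Θ ∧ IsMinOn (fun t => ‖ζ x - y (x, t)‖ ^ 2) Θ (θstar x)) ∧
  ∃ ω₀ : ℝ, 0 < ω₀ ∧ ∀ t ∈ Θ, ∀ x : X,
    ω₀ * ‖t - θstar x‖ ^ 2 ≤ ‖ζ x - y (x, t)‖ ^ 2 - ‖ζ x - y (x, θstar x)‖ ^ 2

/-- The penalized least squares criterion
`n⁻¹ ∑ |z_i - ŷ(x_i, θ(x_i))|² + lam ∑ ‖θ_j‖_𝒩²` for observations `z_1, …, z_n`. -/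
def criterion {d q r n : ℕ} {X : Set (EuclideanSpace ℝ (Fin d))} (Φ : X → X → ℝ)
    (P : Submodule ℝ (X → ℝ)) (x : Fin n → X) (z : Fin n → EuclideanSpace ℝ (Fin r))
    (yhat : EuclideanSpace ℝ (Fin d) × EuclideanSpace ℝ (Fin q) → EuclideanSpace ℝ (Fin r))
    (lam : ℝ) (θ : X → EuclideanSpace ℝ (Fin q)) : ℝ :=
  (1 / (n : ℝ)) * ∑ i, ‖z i - yhat (x i, θ (x i))‖ ^ 2
    + lam * ∑ j, nativeNorm Φ P (fun s => θ s j) ^ 2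

/-- `θ` is a minimizer of the criterion over `𝒩^Θ`. -/
def IsEstimate {d q r n : ℕ} {X : Set (EuclideanSpace ℝ (Fin d))} (Φ : X → X → ℝ)
    (P : Submodule ℝ (X → ℝ)) (Θ : Set (EuclideanSpace ℝ (Fin q))) (x : Fin n → X)
    (z : Fin n → EuclideanSpace ℝ (Fin r))
    (yhat : EuclideanSpace ℝ (Fin d) × EuclideanSpace ℝ (Fin q) → EuclideanSpace ℝ (Fin r))
    (lam : ℝ) (θ : X → EuclideanSpace ℝ (Fin q)) : Prop :=
  θ ∈ nativeSpaceIn Φ P Θ ∧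
    IsMinOn (criterion Φ P x z yhat lam) (nativeSpaceIn Φ P Θ) θ

end

end FunCalib

/-!
Comparing the penalized least squares criterion at `θ̂` and at `θ*` gives a basic inequality: the
quadratic margin of `θ*` bounds `ω₀‖θ̂ - θ*‖_n² + λ‖θ̂‖²_𝒩` by penalty and emulation errors, plus
the noise term `n⁻¹ ∑ ⟪ŷ(xᵢ, θ̂(xᵢ)) - ŷ(xᵢ, θ*(xᵢ)), eᵢ⟫`. Let `a = n^{-ν/(2ν+d)}` and let `t` be
the larger of `‖θ̂‖_𝒩` and `‖θ̂ - θ*‖_n / a`. Since `ŷ` is Lipschitz in the parameter, the entropy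
of a native ball bounds the entropy of the noise process, and `d/ν < 2` makes the chaining sums
converge. As `n a² = a^{-d/ν}`, peeling over dyadic values of `t` shows that, with probability close
to one, the noise term is `O(t^{3/2} a²)` uniformly in `θ̂` with `t ≥ 1`. The basic inequality then
reads `t² a² ≲ t^{3/2} a²`, so `t = O_p(1)`. This contains the bound on `‖θ̂‖_𝒩`, and the design
condition turns it into the `L₂` rate.
-/

namespace FunCalib

open Set Topology

/-! ### Mean value inequalities along Lipschitz curves -/

section MeanValue

variable {E F : Type*} [NormedAddCommGroup F]

lemma norm_sub_le_of_eventually_right {g : ℝ → F} {a b C : ℝ} (hab : a ≤ b)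
    (hg : ContinuousOn g (Icc a b))
    (hC : ∀ t ∈ Ico a b, ∀ᶠ u in 𝓝[>] t, ‖g u - g t‖ ≤ C * (u - t)) :
    ‖g b - g a‖ ≤ C * (b - a) := by
  refine image_le_of_liminf_slope_right_le_deriv_boundary (f := fun t => ‖g t - g a‖)
    (B := fun t => C * (t - a)) (B' := fun _ => C) (hg.sub continuousOn_const).norm (by simp)
    (by fun_prop) (fun t _ => ?_) (fun t ht R hR => Eventually.frequently ?_) ⟨hab, le_rfl⟩
  · simpa using (((hasDerivAt_id t).sub_const a).const_mul C).hasDerivWithinAt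
  · filter_upwards [hC t ht, self_mem_nhdsWithin] with u hu htu
    have h := norm_sub_norm_le (g u - g a) (g t - g a)
    rw [sub_sub_sub_cancel_right] at h
    rw [slope_def_field, div_lt_iff₀ (sub_pos.2 htu)]
    exact (h.trans hu).trans_lt (mul_lt_mul_of_pos_right hR (sub_pos.2 htu))

variable [NormedSpace ℝ F] [NormedAddCommGroup E] [NormedSpace ℝ E]

lemma eventually_norm_sub_le_of_hasFDerivWithinAt {f : E → F} {f' : E →L[ℝ] F} {s : Set E}
    {x : E} {K : ℝ} (hf : HasFDerivWithinAt f f' s x) (hK : ‖f'‖ < K) :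
    ∀ᶠ y in 𝓝[s] x, ‖f y - f x‖ ≤ K * ‖y - x‖ := by
  filter_upwards [(hasFDerivWithinAt_iff_isLittleO.1 hf).def (sub_pos.2 hK)] with y hy
  calc ‖f y - f x‖ ≤ ‖f y - f x - f' (y - x)‖ + ‖f' (y - x)‖ := norm_le_norm_sub_add _ _
    _ ≤ (K - ‖f'‖) * ‖y - x‖ + ‖f'‖ * ‖y - x‖ := add_le_add hy (f'.le_opNorm _)
    _ = K * ‖y - x‖ := by ring

lemma norm_sub_le_of_lipschitzOnWith_curve {f : E → F} {s : Set E} {K : ℝ} {l : NNReal}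
    {γ : ℝ → E} {a b : ℝ} (hab : a ≤ b) (hγ : LipschitzOnWith l γ (Icc a b))
    (hs : MapsTo γ (Icc a b) s)
    (hf : ∀ z ∈ s, ∃ f' : E →L[ℝ] F, HasFDerivWithinAt f f' s z ∧ ‖f'‖ ≤ K) :
    ‖f (γ b) - f (γ a)‖ ≤ K * (l * (b - a)) := by
  suffices h : ∀ R, K < R → ‖f (γ b) - f (γ a)‖ ≤ R * (l * (b - a)) by
    refine ge_of_tendsto (x := 𝓝[>] K) (((continuous_mul_const _).tendsto K).mono_left
      nhdsWithin_le_nhds) ?_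
    filter_upwards [self_mem_nhdsWithin] with R hR using h R hR
  intro R hR
  rw [← mul_assoc]
  -- `γ` need not be differentiable, so the slopes of `f ∘ γ` are bounded without a chain rule.
  refine norm_sub_le_of_eventually_right (g := f ∘ γ) hab (fun t ht => ?_) fun t ht => ?_
  · obtain ⟨f', hf', -⟩ := hf _ (hs ht)
    exact hf'.continuousWithinAt.comp (hγ.continuousOn t ht) hs
  · have htI : t ∈ Icc a b := Ico_subset_Icc_self ht
    obtain ⟨f', hf', hK⟩ := hf _ (hs htI)
    have hR0 : 0 ≤ R := (norm_nonneg f').trans (hK.trans hR.le)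
    have hmem : Icc a b ∈ 𝓝[>] t := Icc_mem_nhdsGT_of_mem ht
    have hlim : Tendsto γ (𝓝[>] t) (𝓝[s] γ t) :=
      tendsto_nhdsWithin_iff.2 ⟨(hγ.continuousOn t htI).mono_left (nhdsWithin_le_of_mem hmem),
        mem_of_superset hmem hs⟩
    filter_upwards [hlim.eventually
      (eventually_norm_sub_le_of_hasFDerivWithinAt hf' (hK.trans_lt hR)), hmem,
      self_mem_nhdsWithin] with u hu huI htu
    calc ‖f (γ u) - f (γ t)‖ ≤ R * ‖γ u - γ t‖ := hu
      _ ≤ R * (l * ‖u - t‖) := by gcongr; exact hγ.norm_sub_le huI htI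
      _ = R * l * (u - t) := by rw [Real.norm_of_nonneg (sub_pos.2 htu).le, mul_assoc]

lemma exists_bound_hasFDerivWithinAt_of_contDiffOn {f : E → F} {s : Set E} (hs : IsCompact s)
    (hf : ContDiffOn ℝ 1 f s) :
    ∃ K, ∀ x ∈ s, ∃ f' : E →L[ℝ] F, HasFDerivWithinAt f f' s x ∧ ‖f'‖ ≤ K := by
  refine hs.induction_on
    (p := fun t => ∃ K, ∀ x ∈ t, ∃ f' : E →L[ℝ] F, HasFDerivWithinAt f f' s x ∧ ‖f'‖ ≤ K)
    ⟨0, by simp⟩ (fun t u htu ⟨K, hK⟩ => ⟨K, fun x hx => hK x (htu hx)⟩) ?_ fun x hx => ?_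
  · rintro t u ⟨K, hK⟩ ⟨L, hL⟩
    refine ⟨max K L, fun x hx => hx.elim (fun h => ?_) fun h => ?_⟩
    · exact (hK x h).imp fun _ => And.imp_right (le_max_of_le_left ·)
    · exact (hL x h).imp fun _ => And.imp_right (le_max_of_le_right ·)
  · have hfx := hf x hx
    rw [← zero_add (1 : WithTop ℕ∞), contDiffWithinAt_succ_iff_hasFDerivWithinAt' (by simp),
      insert_eq_of_mem hx] at hfx
    obtain ⟨u, hu, -, -, f', hf', hcont⟩ := hfx
    have hbound : ∀ᶠ z in 𝓝[s] x, ‖f' z‖ < ‖f' x‖ + 1 :=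
      hcont.continuousWithinAt.norm.eventually (gt_mem_nhds (lt_add_one _))
    exact ⟨_, inter_mem hu hbound, ‖f' x‖ + 1, fun z hz => ⟨f' z, hf' z hz.1, le_of_lt hz.2⟩⟩

end MeanValue

/-! ### Computer models and emulators as Lipschitz families -/

section BoundedLipschitzOn

variable {Z F G : Type*} [NormedAddCommGroup F] [NormedAddCommGroup G]

/-- The maps `f z`, for `z : Z`, are bounded by `B` and Lipschitz with constant `B` on `Θ`. A
single constant serves for both, so that computer models `y (z, ·)` and emulation errors, whose
`C¹` norm tends to zero, are handled alike. -/
structure BoundedLipschitzOn (B : ℝ) (Θ : Set F) (f : Z → F → G) : Prop where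
  norm_le : ∀ z, ∀ s ∈ Θ, ‖f z s‖ ≤ B
  norm_sub_le : ∀ z, ∀ s ∈ Θ, ∀ t ∈ Θ, ‖f z s - f z t‖ ≤ B * ‖s - t‖

variable {Θ : Set F} {A B : ℝ} {f g : Z → F → G}

lemma BoundedLipschitzOn.mono (hf : BoundedLipschitzOn A Θ f) (hAB : A ≤ B) :
    BoundedLipschitzOn B Θ f where
  norm_le z s hs := (hf.norm_le z s hs).trans hAB
  norm_sub_le z s hs t ht := (hf.norm_sub_le z s hs t ht).trans (by gcongr)

lemma BoundedLipschitzOn.add (hf : BoundedLipschitzOn A Θ f) (hg : BoundedLipschitzOn B Θ g) :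
    BoundedLipschitzOn (A + B) Θ fun z s => f z s + g z s where
  norm_le z s hs := norm_add_le_of_le (hf.norm_le z s hs) (hg.norm_le z s hs)
  norm_sub_le z s hs t ht := by
    rw [add_sub_add_comm, add_mul]
    exact norm_add_le_of_le (hf.norm_sub_le z s hs t ht) (hg.norm_sub_le z s hs t ht)

lemma BoundedLipschitzOn.const_sub {ζ : Z → G} (hζ : ∀ z, ‖ζ z‖ ≤ A) (hA : 0 ≤ A)
    (hf : BoundedLipschitzOn B Θ f) : BoundedLipschitzOn (A + B) Θ fun z s => ζ z - f z s where
  norm_le z s hs := norm_sub_le_of_le (hζ z) (hf.norm_le z s hs)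
  norm_sub_le z s hs t ht := by
    rw [sub_sub_sub_cancel_left, norm_sub_rev]
    exact (hf.norm_sub_le z s hs t ht).trans (by gcongr; exact le_add_of_nonneg_left hA)

end BoundedLipschitzOn

section CalibrationDomain

variable {E G : Type*} [NormedAddCommGroup E] [NormedSpace ℝ E] [NormedAddCommGroup G]
  [NormedSpace ℝ G] {q : ℕ} {X : Set E} {Θ : Set (EuclideanSpace ℝ (Fin q))}

lemma LocallyQuasiconvex.exists_norm_sub_le (hΘ : LocallyQuasiconvex Θ) :
    ∃ A, 1 ≤ A ∧ ∀ (f : EuclideanSpace ℝ (Fin q) → G) (B : ℝ), 0 ≤ B →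
      (∀ s ∈ Θ, ‖f s‖ ≤ B) →
      (∀ s ∈ Θ, ∃ f' : EuclideanSpace ℝ (Fin q) →L[ℝ] G,
        HasFDerivWithinAt f f' Θ s ∧ ‖f'‖ ≤ B) →
      ∀ s ∈ Θ, ∀ t ∈ Θ, ‖f s - f t‖ ≤ A * B * ‖s - t‖ := by
  obtain ⟨c, δ, hδ, hcurve⟩ := hΘ
  refine ⟨max c 1 + 2 / δ, le_add_of_le_of_nonneg (le_max_right _ _) (by positivity),
    fun f B hB hf hf' s hs t ht => ?_⟩
  rw [add_mul, add_mul]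
  rcases le_or_gt (dist t s) δ with hts | hts
  · obtain ⟨γ, rfl, rfl, hγΘ, hγ⟩ := hcurve t ht s hs hts
    have hlip : LipschitzOnWith (max c 1 * dist (γ 0) (γ 1)).toNNReal γ (Icc 0 1) := by
      refine LipschitzOnWith.of_dist_le_mul fun u hu v hv => (hγ u hu v hv).trans ?_
      rw [Real.coe_toNNReal _ (by positivity), Real.dist_eq]
      gcongr
      exact le_max_left _ _
    have h := norm_sub_le_of_lipschitzOnWith_curve zero_le_one hlip hγΘ hf'
    rw [Real.coe_toNNReal _ (by positivity), sub_zero, mul_one, dist_comm, dist_eq_norm,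
      ← mul_assoc, mul_comm B] at h
    exact le_add_of_le_of_nonneg h (by positivity)
  · rw [dist_comm, dist_eq_norm] at hts
    refine le_add_of_nonneg_of_le (by positivity) ?_
    calc ‖f s - f t‖ ≤ B + B := norm_sub_le_of_le (hf s hs) (hf t ht)
      _ = 2 / δ * B * δ := by field_simp; ring
      _ ≤ 2 / δ * B * ‖s - t‖ := by gcongr

lemma LocallyQuasiconvex.exists_boundedLipschitzOn (hΘ : LocallyQuasiconvex Θ) :
    ∃ A, 0 ≤ A ∧ ∀ (g : E × EuclideanSpace ℝ (Fin q) → G) (B : ℝ), 0 ≤ B →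
      (∀ p ∈ X ×ˢ Θ, ‖g p‖ ≤ B) →
      (∀ p ∈ X ×ˢ Θ, ∃ g' : E × EuclideanSpace ℝ (Fin q) →L[ℝ] G,
        HasFDerivWithinAt g g' (X ×ˢ Θ) p ∧ ‖g'.comp (.inr ℝ E _)‖ ≤ B) →
      BoundedLipschitzOn (A * B) Θ fun (z : X) t => g (z, t) := by
  obtain ⟨A, hA1, hA⟩ := hΘ.exists_norm_sub_le (G := G)
  refine ⟨A, zero_le_one.trans hA1, fun g B hB hg hg' => ⟨fun z s hs => ?_, fun z => ?_⟩⟩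
  · exact (hg _ ⟨z.2, hs⟩).trans (le_mul_of_one_le_left hB hA1)
  · refine hA _ B hB (fun s hs => hg _ ⟨z.2, hs⟩) fun s hs => ?_
    obtain ⟨g', hder, hnorm⟩ := hg' (z, s) ⟨z.2, hs⟩
    exact ⟨_, hder.comp s (hasFDerivAt_prodMk_right (z : E) s).hasFDerivWithinAt
      fun t ht => ⟨z.2, ht⟩, hnorm⟩

lemma exists_boundedLipschitzOn_of_contDiffOn (hX : IsCompact X) (hΘc : IsCompact Θ)
    (hΘ : LocallyQuasiconvex Θ) {g : E × EuclideanSpace ℝ (Fin q) → G}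
    (hg : ContDiffOn ℝ 1 g (X ×ˢ Θ)) :
    ∃ B, 0 ≤ B ∧ BoundedLipschitzOn B Θ fun (z : X) t => g (z, t) := by
  have hXΘ := hX.prod hΘc
  obtain ⟨M, hM⟩ := hXΘ.exists_bound_of_continuousOn hg.continuousOn
  obtain ⟨K, hK⟩ := exists_bound_hasFDerivWithinAt_of_contDiffOn hXΘ hg
  obtain ⟨A, hA, hlip⟩ := hΘ.exists_boundedLipschitzOn (X := X) (G := G)
  have hB : 0 ≤ max (max M K) 0 := le_max_right _ _
  refine ⟨A * max (max M K) 0, by positivity, hlip g _ hB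
    (fun p hp => (hM p hp).trans (by simp)) fun p hp => ?_⟩
  obtain ⟨g', hg', hgK⟩ := hK p hp
  refine ⟨g', hg', ?_⟩
  calc ‖g'.comp (.inr ℝ E _)‖ ≤ ‖g'‖ * ‖ContinuousLinearMap.inr ℝ E (EuclideanSpace ℝ (Fin q))‖ :=
        g'.opNorm_comp_le _
    _ ≤ ‖g'‖ := mul_le_of_le_one_right (norm_nonneg _) (ContinuousLinearMap.norm_inr_le_one ..)
    _ ≤ max (max M K) 0 := hgK.trans (by simp)

end CalibrationDomain

section Emulator

variable {d q r : ℕ} {X : Set (EuclideanSpace ℝ (Fin d))} {Θ : Set (EuclideanSpace ℝ (Fin q))}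

lemma norm_le_sqrt_mul_of_forall_abs_le {w : EuclideanSpace ℝ (Fin r)} {B : ℝ} (hB : 0 ≤ B)
    (hw : ∀ k, |w k| ≤ B) : ‖w‖ ≤ √r * B := by
  have h := (EuclideanSpace.basisFun (Fin r) ℝ).norm_le_card_mul_iSup_norm_inner w
  rw [Fintype.card_fin] at h
  refine h.trans (mul_le_mul_of_nonneg_left (Real.iSup_le (fun k => ?_) hB) (Real.sqrt_nonneg _))
  simpa [EuclideanSpace.inner_single_left] using hw k

lemma abs_le_and_abs_fderivWithin_le_of_c1Norm_le
    {Γ : Set (EuclideanSpace ℝ (Fin d) × EuclideanSpace ℝ (Fin q))}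
    {g : EuclideanSpace ℝ (Fin d) × EuclideanSpace ℝ (Fin q) → EuclideanSpace ℝ (Fin r)}
    {B : ℝ} (hB : 0 ≤ B) (hg : c1Norm Γ g ≤ ENNReal.ofReal B) {p} (hp : p ∈ Γ) (k : Fin r) :
    |g p k| ≤ B ∧ ∀ j : Fin q, |fderivWithin ℝ g Γ p (0, EuclideanSpace.single j 1) k| ≤ B := by
  have h := (le_iSup_of_le p (le_iSup_of_le hp (le_iSup_of_le k le_rfl))).trans hg
  simp only [max_le_iff, iSup_le_iff, Real.enorm_eq_ofReal_abs, ENNReal.ofReal_le_ofReal_iff hB]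
    at h
  exact h.imp_right And.right

lemma LocallyQuasiconvex.exists_boundedLipschitzOn_of_c1Norm_le (hΘ : LocallyQuasiconvex Θ) :
    ∃ A, 0 ≤ A ∧
      ∀ g : EuclideanSpace ℝ (Fin d) × EuclideanSpace ℝ (Fin q) → EuclideanSpace ℝ (Fin r),
      ContDiffOn ℝ 1 g (X ×ˢ Θ) → ∀ B, 0 ≤ B → c1Norm (X ×ˢ Θ) g ≤ ENNReal.ofReal B →
      BoundedLipschitzOn (A * B) Θ fun (z : X) t => g (z, t) := by
  obtain ⟨A, hA, hlip⟩ := hΘ.exists_boundedLipschitzOn (X := X) (G := EuclideanSpace ℝ (Fin r))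
  obtain ⟨D, -, hbasis⟩ := (EuclideanSpace.basisFun (Fin q) ℝ).toBasis.exists_opNorm_le
    (F := EuclideanSpace ℝ (Fin r))
  refine ⟨A * (max 1 D * √r), by positivity, fun g hg B hB hgB => ?_⟩
  have hsqrt : 0 ≤ √r * B := by positivity
  rw [mul_assoc A, mul_assoc]
  refine hlip g _ (by positivity) (fun p hp => ?_) fun p hp => ⟨_,
    ((hg p hp).differentiableWithinAt one_ne_zero).hasFDerivWithinAt, ?_⟩
  · calc ‖g p‖ ≤ √r * B := norm_le_sqrt_mul_of_forall_abs_le hB fun k =>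
          (abs_le_and_abs_fderivWithin_le_of_c1Norm_le hB hgB hp k).1
      _ ≤ max 1 D * (√r * B) := le_mul_of_one_le_left hsqrt (le_max_left _ _)
  · refine (hbasis hsqrt fun j => ?_).trans (mul_le_mul_of_nonneg_right (le_max_right _ _) hsqrt)
    refine norm_le_sqrt_mul_of_forall_abs_le hB fun k => ?_
    simpa using (abs_le_and_abs_fderivWithin_le_of_c1Norm_le hB hgB hp k).2 j

/-- The rate of convergence `n^{-ν/(2ν+d)}`: the accuracy of the emulators and the critical radius
of the empirical process. -/
noncomputable def rate (ν : ℝ) (d n : ℕ) : ℝ := (n : ℝ) ^ (-(ν / (2 * ν + d)))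

lemma rate_nonneg (ν : ℝ) (d n : ℕ) : 0 ≤ rate ν d n := Real.rpow_nonneg n.cast_nonneg _

lemma EmulatorCondition.exists_boundedLipschitzOn {ν : ℝ}
    {y : EuclideanSpace ℝ (Fin d) × EuclideanSpace ℝ (Fin q) → EuclideanSpace ℝ (Fin r)}
    {yhat : ℕ → EuclideanSpace ℝ (Fin d) × EuclideanSpace ℝ (Fin q) →
      EuclideanSpace ℝ (Fin r)}
    (hemu : EmulatorCondition (X ×ˢ Θ) ν y yhat) (hΘ : LocallyQuasiconvex Θ)
    (hy : ContDiffOn ℝ 1 y (X ×ˢ Θ)) :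
    ∃ C, 0 ≤ C ∧ ∀ᶠ n : ℕ in atTop, BoundedLipschitzOn (C * rate ν d n) Θ
      fun (z : X) t => yhat n (z, t) - y (z, t) := by
  obtain ⟨hyhat, C, hC⟩ := hemu
  obtain ⟨A, hA, hlip⟩ := hΘ.exists_boundedLipschitzOn_of_c1Norm_le (X := X) (r := r)
  refine ⟨A * max C 0, by positivity, hC.mono fun n hn => ?_⟩
  rw [mul_assoc]
  have hrate := rate_nonneg ν d n
  exact hlip _ ((hyhat n).sub hy) _ (by positivity)
    (hn.trans (ENNReal.ofReal_le_ofReal (mul_le_mul_of_nonneg_right (le_max_left C 0) hrate)))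

end Emulator

/-! ### Native semi-norms and nets -/

section NativeSpace

variable {S : Type*} {Φ : S → S → ℝ} {P : Submodule ℝ (S → ℝ)} {f g : S → ℝ} {q : ℕ}

lemma pairing_sub (c : S →₀ ℝ) (f g : S → ℝ) :
    pairing c (fun s => f s - g s) = pairing c f - pairing c g := by
  simp [pairing, Finsupp.sum, mul_sub, Finset.sum_sub_distrib]

lemma nativeNorm_nonneg (f : S → ℝ) : 0 ≤ nativeNorm Φ P f :=
  Real.sInf_nonneg fun _ hC => hC.1

lemma NativeBound.nativeNorm_le {C : ℝ} (h : NativeBound Φ P f C) : nativeNorm Φ P f ≤ C :=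
  csInf_le ⟨0, fun _ hC => hC.1⟩ h

lemma nativeBound_nativeNorm (hf : f ∈ nativeSpace Φ P) :
    NativeBound Φ P f (nativeNorm Φ P f) := by
  refine ⟨nativeNorm_nonneg f, fun c hc => ?_⟩
  rcases (Real.sqrt_nonneg (quadForm Φ c)).eq_or_lt with h | h
  · obtain ⟨C, -, hC⟩ := hf
    have := hC c hc
    rwa [← h, mul_zero] at this ⊢
  · rw [← div_le_iff₀ h]
    exact le_csInf hf fun C hC => (div_le_iff₀ h).2 (hC.2 c hc)

lemma NativeBound.sub {C D : ℝ} (hf : NativeBound Φ P f C) (hg : NativeBound Φ P g D) :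
    NativeBound Φ P (fun s => f s - g s) (C + D) := by
  refine ⟨add_nonneg hf.1 hg.1, fun c hc => ?_⟩
  rw [pairing_sub, add_mul]
  exact (abs_sub _ _).trans (add_le_add (hf.2 c hc) (hg.2 c hc))

lemma sub_mem_nativeSpace (hf : f ∈ nativeSpace Φ P) (hg : g ∈ nativeSpace Φ P) :
    (fun s => f s - g s) ∈ nativeSpace Φ P :=
  ⟨_, (nativeBound_nativeNorm hf).sub (nativeBound_nativeNorm hg)⟩

lemma nativeNorm_sub_le (hf : f ∈ nativeSpace Φ P) (hg : g ∈ nativeSpace Φ P) :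
    nativeNorm Φ P (fun s => f s - g s) ≤ nativeNorm Φ P f + nativeNorm Φ P g :=
  ((nativeBound_nativeNorm hf).sub (nativeBound_nativeNorm hg)).nativeNorm_le

lemma nativeNormVec_nonneg (f : S → EuclideanSpace ℝ (Fin q)) : 0 ≤ nativeNormVec Φ P f :=
  Real.sqrt_nonneg _

lemma nativeNormVec_sq (f : S → EuclideanSpace ℝ (Fin q)) :
    nativeNormVec Φ P f ^ 2 = ∑ j, nativeNorm Φ P (fun s => f s j) ^ 2 :=
  Real.sq_sqrt (Finset.sum_nonneg fun _ _ => sq_nonneg _)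

lemma nativeNorm_le_nativeNormVec (f : S → EuclideanSpace ℝ (Fin q)) (j : Fin q) :
    nativeNorm Φ P (fun s => f s j) ≤ nativeNormVec Φ P f := by
  refine le_of_sq_le_sq ?_ (nativeNormVec_nonneg f)
  rw [nativeNormVec_sq]
  exact Finset.single_le_sum (f := fun j => nativeNorm Φ P (fun s => f s j) ^ 2)
    (fun _ _ => sq_nonneg _) (Finset.mem_univ j)

end NativeSpace

section Nets

variable {S : Type*} {q : ℕ}

lemma exists_coveredBy_of_coveringNumber_eq {δ : ℝ} {A : Set (S → ℝ)} {N : ℕ}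
    (h : coveringNumber δ A = N) : ∃ N' ≤ N, CoveredBy δ A N' := by
  have hlt : coveringNumber δ A < ((N + 1 : ℕ) : ℕ∞) := by
    rw [h]
    exact_mod_cast N.lt_succ_self
  simp only [coveringNumber, iInf_lt_iff, Nat.cast_lt, Nat.lt_succ_iff, exists_prop] at hlt
  exact hlt.imp fun _ => And.symm

lemma CoveredBy.exists_net {N : ℕ} {δ : ℝ} {A : Set (S → ℝ)} (hδ : 0 ≤ δ) (hA : CoveredBy δ A N)
    {T : Set (S → EuclideanSpace ℝ (Fin q))} (hT : ∀ f ∈ T, ∀ j, (fun s => f s j) ∈ A) :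
    ∃ F : Finset (S → EuclideanSpace ℝ (Fin q)), (F : Set _) ⊆ T ∧ F.card ≤ N ^ q ∧
      ∀ f ∈ T, ∃ g ∈ F, ∀ s, ‖f s - g s‖ ≤ √q * (2 * δ) := by
  classical
  obtain ⟨c, hc⟩ := hA
  choose ι hι using fun (f : T) j => hc _ (hT f f.2 j)
  refine ⟨Finset.univ.image fun i : range ι => (rangeSplitting ι i).1, ?_, ?_, ?_⟩
  · simp [range_subset_iff]
  · exact Finset.card_image_le.trans ((set_fintype_card_le_univ _).trans_eq (by simp))
  · intro f hf
    have hfι : ι ⟨f, hf⟩ ∈ range ι := mem_range_self _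
    set g : T := rangeSplitting ι ⟨_, hfι⟩
    have hg : ι g = ι ⟨f, hf⟩ := apply_rangeSplitting ι ⟨_, hfι⟩
    refine ⟨g, Finset.mem_image_of_mem _ (Finset.mem_univ _), fun s => ?_⟩
    refine norm_le_sqrt_mul_of_forall_abs_le (by positivity) fun k => ?_
    calc |(f s - g.1 s) k|
        ≤ |f s k - c (ι g k) s| + |g.1 s k - c (ι g k) s| := by
          rw [abs_sub_comm (g.1 s k)]
          exact abs_sub_le _ _ _
      _ ≤ 2 * δ := by
          rw [two_mul]
          exact add_le_add (hg ▸ hι ⟨f, hf⟩ k s) (hι g k s)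

lemma EntropyCondition.exists_net {Φ : S → S → ℝ} {P : Submodule ℝ (S → ℝ)} {d : ℕ} {ν : ℝ}
    (hent : EntropyCondition Φ P d ν) (q : ℕ) :
    ∃ C, 0 ≤ C ∧ ∀ ε ρ, 0 < ε → 0 < ρ → ∀ T : Set (S → EuclideanSpace ℝ (Fin q)),
      (∀ f ∈ T, ∀ j, (fun s => f s j) ∈ nativeBall Φ P ρ) →
      ∃ F : Finset (S → EuclideanSpace ℝ (Fin q)), (F : Set _) ⊆ T ∧
        (F.card : ℝ) ≤ Real.exp (C * (ρ / ε) ^ ((d : ℝ) / ν)) ∧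
        ∀ f ∈ T, ∃ g ∈ F, ∀ s, ‖f s - g s‖ ≤ ε := by
  obtain ⟨C, hC, h⟩ := hent
  refine ⟨q * (C * (2 * (√q + 1))) ^ ((d : ℝ) / ν), by positivity, fun ε ρ hε hρ T hT => ?_⟩
  set δ := ε / (2 * (√q + 1)) with hδ
  have hδ0 : 0 < δ := by positivity
  obtain ⟨N, hN, hlog⟩ := h δ ρ hδ0 hρ
  obtain ⟨N', hN', hcov⟩ := exists_coveredBy_of_coveringNumber_eq hN
  obtain ⟨F, hFT, hFc, hF⟩ := hcov.exists_net hδ0.le hT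
  refine ⟨F, hFT, ?_, fun f hf => ?_⟩
  · have hscale : C * ρ / δ = C * (2 * (√q + 1)) * (ρ / ε) := by rw [hδ]; field_simp
    rw [hscale, Real.mul_rpow (by positivity) (by positivity)] at hlog
    calc (F.card : ℝ) ≤ (N : ℝ) ^ q := by exact_mod_cast hFc.trans (Nat.pow_le_pow_left hN' q)
      _ ≤ Real.exp (Real.log N) ^ q := by gcongr; exact Real.le_exp_log _
      _ = Real.exp (q * Real.log N) := by rw [← Real.exp_nat_mul]
      _ ≤ _ := by rw [mul_assoc]; gcongr
  · obtain ⟨g, hg, hfg⟩ := hF f hf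
    refine ⟨g, hg, fun s => (hfg s).trans ?_⟩
    calc √q * (2 * δ) ≤ (√q + 1) * (2 * δ) := by gcongr; linarith
      _ = ε := by rw [hδ]; field_simp

end Nets

/-! ### Chaining for sub-Gaussian vectors -/

section SubGaussian

variable {Ω : Type*} [MeasurableSpace Ω] {μ : Measure Ω} {V : Type*} [NormedAddCommGroup V]
  [InnerProductSpace ℝ V] {σ : ℝ}

/-- Every linear functional `⟪w, ξ⟫` of the random vector `ξ` is centered and sub-Gaussian with
variance proxy `σ²‖w‖²`. Unlike `IsSubGaussian` this makes sense in any inner product space, in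
particular for the vector of all noise terms. -/
def IsSubGaussianVector (ξ : Ω → V) (σ : ℝ) (μ : Measure Ω) : Prop :=
  ∀ w : V, HasSubgaussianMGF (fun ω => inner ℝ w (ξ ω)) (σ ^ 2 * ‖w‖ ^ 2).toNNReal μ

lemma IsSubGaussian.isSubGaussianVector {r : ℕ} {ξ : Ω → EuclideanSpace ℝ (Fin r)}
    (h : IsSubGaussian ξ σ μ) (h0 : ∫ ω, ξ ω ∂μ = 0) : IsSubGaussianVector ξ σ μ := by
  refine fun w => ⟨fun t => ?_, fun t => ?_⟩
  · simpa [h0, inner_smul_left] using h.integrable_exp (t • w)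
  · have hexp : (σ ^ 2 * ‖w‖ ^ 2) * t ^ 2 / 2 = σ ^ 2 * ‖t • w‖ ^ 2 / 2 := by
      rw [norm_smul, mul_pow, Real.norm_eq_abs, sq_abs]
      ring
    rw [Real.coe_toNNReal _ (by positivity), hexp]
    simpa [mgf, h0, inner_smul_left] using h.bound (t • w)

lemma IsSubGaussianVector.toLp [MeasurableSpace V] [OpensMeasurableSpace V] {ι : Type*}
    [Fintype ι] {ξ : ι → Ω → V} (hind : iIndepFun ξ μ)
    (hξ : ∀ i, IsSubGaussianVector (ξ i) σ μ) :
    IsSubGaussianVector (fun ω => WithLp.toLp 2 fun i => ξ i ω) σ μ := by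
  intro w
  have hind' : iIndepFun (fun i ω => inner ℝ (w i) (ξ i ω)) μ :=
    hind.comp (fun i v => inner ℝ (w i) v) fun i => (by fun_prop : Continuous _).measurable
  have hproxy : (σ ^ 2 * ‖w‖ ^ 2).toNNReal = ∑ i, (σ ^ 2 * ‖w i‖ ^ 2).toNNReal := by
    rw [PiLp.norm_sq_eq_of_L2, Finset.mul_sum,
      Real.toNNReal_sum_of_nonneg fun _ _ => by positivity]
  rw [hproxy]
  exact HasSubgaussianMGF.sum_of_iIndepFun hind' (s := Finset.univ) fun i _ => hξ i (w i)

variable {ξ : Ω → V}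

lemma IsSubGaussianVector.measure_inner_ge_le [IsFiniteMeasure μ]
    (hξ : IsSubGaussianVector ξ σ μ) (hσ : 0 < σ) {w : V} (hw : w ≠ 0) {τ : ℝ} (hτ : 0 ≤ τ) :
    μ {ω | σ * ‖w‖ * τ ≤ inner ℝ w (ξ ω)} ≤ ENNReal.ofReal (Real.exp (-τ ^ 2 / 2)) := by
  rw [← ofReal_measureReal]
  refine ENNReal.ofReal_le_ofReal (((hξ w).measure_ge_le (by positivity)).trans_eq ?_)
  rw [Real.coe_toNNReal _ (by positivity)]
  congr 1
  field_simp

lemma IsSubGaussianVector.measure_abs_inner_gt_le [IsFiniteMeasure μ]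
    (hξ : IsSubGaussianVector ξ σ μ) (hσ : 0 < σ) (w : V) {τ : ℝ} (hτ : 0 ≤ τ) :
    μ {ω | σ * ‖w‖ * τ < |inner ℝ w (ξ ω)|} ≤ ENNReal.ofReal (2 * Real.exp (-τ ^ 2 / 2)) := by
  rcases eq_or_ne w 0 with rfl | hw
  · simp
  have hsub : {ω | σ * ‖w‖ * τ < |inner ℝ w (ξ ω)|} ⊆
      {ω | σ * ‖w‖ * τ ≤ inner ℝ w (ξ ω)} ∪ {ω | σ * ‖-w‖ * τ ≤ inner ℝ (-w) (ξ ω)} := by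
    intro ω hω
    simpa only [mem_union, mem_ofPred_eq, norm_neg, inner_neg_left] using
      (lt_abs.1 hω).imp le_of_lt le_of_lt
  rw [two_mul, ENNReal.ofReal_add (by positivity) (by positivity)]
  exact (measure_mono hsub).trans ((measure_union_le _ _).trans (add_le_add
    (hξ.measure_inner_ge_le hσ hw hτ) (hξ.measure_inner_ge_le hσ (neg_ne_zero.2 hw) hτ)))

lemma IsSubGaussianVector.measure_exists_abs_inner_sub_gt_le [IsFiniteMeasure μ]
    (hξ : IsSubGaussianVector ξ σ μ) (hσ : 0 < σ) (F G : Finset V) {τ : ℝ} (hτ : 0 ≤ τ) :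
    μ {ω | ∃ w ∈ F, ∃ w' ∈ G, σ * ‖w' - w‖ * τ < |inner ℝ (w' - w) (ξ ω)|} ≤
      ENNReal.ofReal (F.card * (G.card * (2 * Real.exp (-τ ^ 2 / 2)))) := by
  have hunion : {ω | ∃ w ∈ F, ∃ w' ∈ G, σ * ‖w' - w‖ * τ < |inner ℝ (w' - w) (ξ ω)|} =
      ⋃ w ∈ F, ⋃ w' ∈ G, {ω | σ * ‖w' - w‖ * τ < |inner ℝ (w' - w) (ξ ω)|} := by
    ext ω
    simp
  rw [hunion, ← nsmul_eq_mul, ← nsmul_eq_mul, ENNReal.ofReal_nsmul, ENNReal.ofReal_nsmul]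
  refine (measure_biUnion_finset_le _ _).trans (Finset.sum_le_card_nsmul _ _ _ fun w _ => ?_)
  exact (measure_biUnion_finset_le _ _).trans (Finset.sum_le_card_nsmul _ _ _ fun w' _ =>
    hξ.measure_abs_inner_gt_le hσ (w' - w) hτ)

end SubGaussian

section Chaining

lemma exp_neg_le_inv {u : ℝ} (hu : 0 < u) : Real.exp (-u) ≤ u⁻¹ := by
  rw [Real.exp_neg]
  exact inv_anti₀ hu (by linarith [Real.add_one_le_exp u])

-- Since `h ≤ 4`, the exponents `N h ^ k` and `N h ^ (k + 1)` of the two nets add up to at most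
-- `5 N h ^ k`, which is where the threshold `5 * N` for `Q` comes from.
lemma mul_mul_exp_le_of_le_exp {h N Q : ℝ} (hh2 : 2 ≤ h) (hh4 : h < 4) (hN : 0 ≤ N)
    (hQ : 5 * N < Q) {c : ℕ → ℕ} (hc : ∀ k, (c k : ℝ) ≤ Real.exp (N * h ^ k)) (k : ℕ) :
    c k * (c (k + 1) * (2 * Real.exp (-√(2 * Q * h ^ k) ^ 2 / 2))) ≤
      2 / (Q - 5 * N) * 2⁻¹ ^ k := by
  have hQ0 : 0 ≤ Q := by linarith
  have hhk : (2 : ℝ) ^ k ≤ h ^ k := pow_le_pow_left₀ zero_le_two hh2 k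
  have hNh : N * h ^ (k + 1) ≤ 4 * (N * h ^ k) := by
    rw [pow_succ']
    nlinarith [mul_nonneg hN (pow_nonneg (zero_le_two.trans hh2) k)]
  rw [Real.sq_sqrt (by positivity)]
  calc c k * (c (k + 1) * (2 * Real.exp (-(2 * Q * h ^ k) / 2)))
      ≤ Real.exp (N * h ^ k) * (Real.exp (N * h ^ (k + 1)) *
          (2 * Real.exp (-(2 * Q * h ^ k) / 2))) := by
        gcongr
        exacts [hc k, hc (k + 1)]
    _ = 2 * Real.exp (N * h ^ k + N * h ^ (k + 1) + -(2 * Q * h ^ k) / 2) := by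
        rw [Real.exp_add, Real.exp_add]
        ring
    _ ≤ 2 * Real.exp (-((Q - 5 * N) * 2 ^ k)) := by
        gcongr
        nlinarith
    _ ≤ 2 * ((Q - 5 * N) * 2 ^ k)⁻¹ := by
        gcongr
        exact exp_neg_le_inv (by positivity)
    _ = 2 / (Q - 5 * N) * 2⁻¹ ^ k := by rw [mul_inv, inv_pow, div_eq_mul_inv, mul_assoc]

variable {V : Type*} [NormedAddCommGroup V] [InnerProductSpace ℝ V]

lemma abs_inner_sub_le_of_chain {v w : V} {π : ℕ → V} {t g : ℝ} (hg0 : 0 ≤ g) (hg1 : g < 1)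
    (ht : 0 ≤ t) (hlim : Tendsto π atTop (𝓝 w))
    (hstep : ∀ k, |inner ℝ (π (k + 1) - π k) v| ≤ t * g ^ k) :
    |inner ℝ (w - π 0) v| ≤ t / (1 - g) := by
  have hpartial : ∀ k, |inner ℝ (π k - π 0) v| ≤ t / (1 - g) := fun k => by
    rw [← Finset.sum_range_sub, sum_inner]
    calc |∑ i ∈ Finset.range k, inner ℝ (π (i + 1) - π i) v|
        ≤ ∑ i ∈ Finset.range k, t * g ^ i :=
          (Finset.abs_sum_le_sum_abs _ _).trans (Finset.sum_le_sum fun i _ => hstep i)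
      _ = t * ∑ i ∈ Finset.range k, g ^ i := by rw [Finset.mul_sum]
      _ ≤ t * ∑' i, g ^ i := by
          gcongr
          exact (summable_geometric_of_lt_one hg0 hg1).sum_le_tsum _ fun i _ => by positivity
      _ = t / (1 - g) := by rw [tsum_geometric_of_lt_one hg0 hg1, div_eq_mul_inv]
  exact le_of_tendsto ((hlim.sub_const (π 0)).inner tendsto_const_nhds).abs
    (Eventually.of_forall hpartial)

variable {Ω : Type*} [MeasurableSpace Ω] {μ : Measure Ω} {ξ : Ω → V} {σ h N Q ρ : ℝ} {w₀ : V}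

/-- The increments of `⟪·, v⟫` along the nets `F k` are small: this holds with large probability
when `v` is sub-Gaussian, and it controls `⟪w, v⟫` for every `w` approximated by the nets. -/
def HasSmallChainIncrements (σ Q h : ℝ) (F : ℕ → Finset V) (v : V) : Prop :=
  ∀ k, ∀ w ∈ F k, ∀ w' ∈ F (k + 1), |inner ℝ (w' - w) v| ≤ σ * ‖w' - w‖ * √(2 * Q * h ^ k)

lemma IsSubGaussianVector.measure_not_hasSmallChainIncrements_le [IsFiniteMeasure μ]
    (hξ : IsSubGaussianVector ξ σ μ) (hσ : 0 < σ) (hh2 : 2 ≤ h) (hh4 : h < 4) (hN : 0 ≤ N)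
    (hQ : 5 * N < Q) {F : ℕ → Finset V} (hFc : ∀ k, ((F k).card : ℝ) ≤ Real.exp (N * h ^ k)) :
    μ {ω | ¬ HasSmallChainIncrements σ Q h F (ξ ω)} ≤ ENNReal.ofReal (4 / (Q - 5 * N)) := by
  have hunion : {ω | ¬ HasSmallChainIncrements σ Q h F (ξ ω)} = ⋃ k, {ω | ∃ w ∈ F k,
      ∃ w' ∈ F (k + 1), σ * ‖w' - w‖ * √(2 * Q * h ^ k) < |inner ℝ (w' - w) (ξ ω)|} := by
    ext ω
    simp [HasSmallChainIncrements]
  calc μ {ω | ¬ HasSmallChainIncrements σ Q h F (ξ ω)}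
      ≤ ∑' k, ENNReal.ofReal (2 / (Q - 5 * N) * 2⁻¹ ^ k) := by
        rw [hunion]
        refine (measure_iUnion_le _).trans (ENNReal.tsum_le_tsum fun k => ?_)
        exact (hξ.measure_exists_abs_inner_sub_gt_le hσ _ _ (Real.sqrt_nonneg _)).trans
          (ENNReal.ofReal_le_ofReal (mul_mul_exp_le_of_le_exp hh2 hh4 hN hQ hFc k))
    _ = ENNReal.ofReal (∑' k : ℕ, 2 / (Q - 5 * N) * 2⁻¹ ^ k) :=
        (ENNReal.ofReal_tsum_of_nonneg (fun k => by positivity)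
          ((summable_geometric_of_lt_one (by norm_num) (by norm_num)).mul_left _)).symm
    _ = ENNReal.ofReal (4 / (Q - 5 * N)) := by
        rw [tsum_mul_left, tsum_geometric_of_lt_one (by norm_num) (by norm_num)]
        congr 1
        ring

lemma HasSmallChainIncrements.abs_inner_sub_le {v w : V} {F : ℕ → Finset V}
    (hF : HasSmallChainIncrements σ Q h F v) (hσ : 0 < σ) (hh0 : 0 ≤ h) (hh4 : h < 4)
    (hQ : 0 ≤ Q) (hF0 : F 0 = {w₀}) (hw : ∀ k, ∃ w' ∈ F k, ‖w - w'‖ ≤ ρ / 2 ^ k) :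
    |inner ℝ (w - w₀) v| ≤ σ * ρ * √(8 * Q) / (1 - √h / 2) := by
  choose π hπF hπ using hw
  have hρ : 0 ≤ ρ := by simpa using (norm_nonneg _).trans (hπ 0)
  have hπ0 : π 0 = w₀ := by simpa [hF0] using hπF 0
  have hg1 : √h / 2 < 1 := by
    rw [div_lt_one zero_lt_two, Real.sqrt_lt' zero_lt_two]
    linarith
  have hgap : ∀ k, ‖π (k + 1) - π k‖ ≤ 2 * ρ / 2 ^ k := fun k => by
    have hhalf : ρ / 2 ^ (k + 1) ≤ ρ / 2 ^ k := by
      gcongr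
      exacts [one_le_two, k.le_succ]
    calc ‖π (k + 1) - π k‖ = ‖(w - π k) - (w - π (k + 1))‖ := by rw [sub_sub_sub_cancel_left]
      _ ≤ ρ / 2 ^ k + ρ / 2 ^ k := norm_sub_le_of_le (hπ k) ((hπ (k + 1)).trans hhalf)
      _ = 2 * ρ / 2 ^ k := by ring
  have hlim : Tendsto π atTop (𝓝 w) := by
    refine tendsto_iff_norm_sub_tendsto_zero.2 (squeeze_zero (fun _ => norm_nonneg _)
      (fun k => (norm_sub_rev _ _).trans_le (hπ k)) ?_)
    exact tendsto_const_nhds.div_atTop (tendsto_pow_atTop_atTop_of_one_lt one_lt_two)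
  have hpow : ∀ k : ℕ, √h ^ k = √(h ^ k) := fun k =>
    (Real.sqrt_eq_iff_mul_self_eq (by positivity) (by positivity)).2
      (by rw [← mul_pow, Real.mul_self_sqrt hh0]) |>.symm
  rw [← hπ0]
  refine abs_inner_sub_le_of_chain (by positivity) hg1 (by positivity) hlim fun k => ?_
  calc |inner ℝ (π (k + 1) - π k) v| ≤ σ * ‖π (k + 1) - π k‖ * √(2 * Q * h ^ k) :=
        hF k _ (hπF k) _ (hπF (k + 1))
    _ ≤ σ * (2 * ρ / 2 ^ k) * √(2 * Q * h ^ k) := by gcongr; exact hgap k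
    _ = σ * ρ * √(8 * Q) * (√h / 2) ^ k := by
        have h8 : √(8 * Q) = 2 * √(2 * Q) := by
          rw [show 8 * Q = 2 ^ 2 * (2 * Q) by ring, Real.sqrt_mul (by positivity),
            Real.sqrt_sq zero_le_two]
        rw [h8, Real.sqrt_mul (x := 2 * Q) (by positivity), ← hpow, div_pow]
        ring

lemma IsSubGaussianVector.measure_exists_peeled_gt_le [IsFiniteMeasure μ]
    (hξ : IsSubGaussianVector ξ σ μ) (hσ : 0 < σ) (hh2 : 2 ≤ h) (hh4 : h < 4) (hN : 1 ≤ N)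
    (hQ : 10 ≤ Q) {A : ℕ → Set V} {F : ℕ → ℕ → Finset V} (hF0 : ∀ j, F j 0 = {w₀})
    (hFc : ∀ j k, ((F j k).card : ℝ) ≤ Real.exp (N * h ^ k))
    (hF : ∀ j, ∀ w ∈ A j, ∀ k, ∃ w' ∈ F j k, ‖w - w'‖ ≤ ρ * 2 ^ j / 2 ^ k) :
    μ {ω | ∃ j, ∃ w ∈ A j, σ * ρ * √(8 * Q * N) / (1 - √h / 2) * (2 ^ j * √(2 ^ j)) <
      |inner ℝ (w - w₀) (ξ ω)|} ≤ ENNReal.ofReal (16 / Q) := by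
  have hQN : ∀ j : ℕ, Q / 2 * 2 ^ j ≤ Q * N * 2 ^ j - 5 * N := fun j => by
    have hj : (1 : ℝ) ≤ 2 ^ j := one_le_pow₀ one_le_two
    nlinarith [mul_le_mul hN hj zero_le_one (by linarith), mul_le_mul hQ hj zero_le_one
      (by linarith), mul_nonneg (sub_nonneg.2 hN) (sub_nonneg.2 hj)]
  have hQN0 : ∀ j : ℕ, 0 < Q / 2 * 2 ^ j := fun j => by positivity
  calc μ {ω | ∃ j, ∃ w ∈ A j, σ * ρ * √(8 * Q * N) / (1 - √h / 2) * (2 ^ j * √(2 ^ j)) <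
        |inner ℝ (w - w₀) (ξ ω)|}
      ≤ μ (⋃ j, {ω | ¬ HasSmallChainIncrements σ (Q * N * 2 ^ j) h (F j) (ξ ω)}) := by
        refine measure_mono fun ω ⟨j, w, hw, hlt⟩ => mem_iUnion.2 ⟨j, fun hsmall => ?_⟩
        refine hlt.not_ge ((hsmall.abs_inner_sub_le hσ (by linarith) hh4 (by positivity) (hF0 j)
          (hF j w hw)).trans_eq ?_)
        rw [show 8 * (Q * N * 2 ^ j) = 8 * Q * N * 2 ^ j by ring, Real.sqrt_mul (by positivity)]
        ring
    _ ≤ ∑' j : ℕ, ENNReal.ofReal (8 / Q * 2⁻¹ ^ j) := by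
        refine (measure_iUnion_le _).trans (ENNReal.tsum_le_tsum fun j => ?_)
        refine (hξ.measure_not_hasSmallChainIncrements_le hσ hh2 hh4 (by linarith)
          (sub_pos.1 ((hQN0 j).trans_le (hQN j))) (hFc j)).trans (ENNReal.ofReal_le_ofReal ?_)
        calc 4 / (Q * N * 2 ^ j - 5 * N) ≤ 4 / (Q / 2 * 2 ^ j) := by
              gcongr
              exact hQN j
          _ = 8 / Q * 2⁻¹ ^ j := by rw [inv_pow]; field_simp; norm_num
    _ = ENNReal.ofReal (∑' j : ℕ, 8 / Q * 2⁻¹ ^ j) :=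
        (ENNReal.ofReal_tsum_of_nonneg (fun j => by positivity)
          ((summable_geometric_of_lt_one (by norm_num) (by norm_num)).mul_left _)).symm
    _ = ENNReal.ofReal (16 / Q) := by
        rw [tsum_mul_left, tsum_geometric_of_lt_one (by norm_num) (by norm_num)]
        congr 1
        ring

end Chaining

/-! ### The noise process -/

section Design

variable {S : Type*} {n q r : ℕ} {E G : Type*} [NormedAddCommGroup E] [NormedAddCommGroup G]
  {x : Fin n → S}

/-- The empirical semi-norm `(n⁻¹ ∑ ‖f(x_i)‖²)^{1/2}` of a vector-valued function. -/
noncomputable def empNormVec (x : Fin n → S) (f : S → E) : ℝ :=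
  √((∑ i, ‖f (x i)‖ ^ 2) / n)

lemma empNormVec_nonneg (f : S → E) : 0 ≤ empNormVec x f := Real.sqrt_nonneg _

lemma empNormVec_sq (f : S → E) : empNormVec x f ^ 2 = (∑ i, ‖f (x i)‖ ^ 2) / n :=
  Real.sq_sqrt (by positivity)

lemma empNormVec_le_of_forall_norm_le {f : S → E} {g : S → G} {c : ℝ} (hc : 0 ≤ c)
    (hfg : ∀ s, ‖f s‖ ≤ c * ‖g s‖) : empNormVec x f ≤ c * empNormVec x g := by
  refine Real.sqrt_le_iff.2 ⟨mul_nonneg hc (empNormVec_nonneg g), ?_⟩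
  rw [mul_pow, empNormVec_sq, mul_div_assoc', Finset.mul_sum]
  gcongr with i
  rw [← mul_pow]
  gcongr
  exact hfg _

lemma empNormVec_le_of_forall_norm_le_const {f : S → E} {δ : ℝ} (hδ : 0 ≤ δ)
    (hf : ∀ s, ‖f s‖ ≤ δ) : empNormVec x f ≤ δ := by
  refine Real.sqrt_le_iff.2 ⟨hδ, div_le_of_le_mul₀ n.cast_nonneg (sq_nonneg δ) ?_⟩
  calc ∑ i, ‖f (x i)‖ ^ 2 ≤ ∑ _i : Fin n, δ ^ 2 := by
        gcongr with i
        exact hf _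
    _ = δ ^ 2 * n := by simp [mul_comm]

lemma sum_norm_div_le_empNormVec (f : S → E) : (∑ i, ‖f (x i)‖) / n ≤ empNormVec x f := by
  refine Real.le_sqrt_of_sq_le ?_
  rcases n.eq_zero_or_pos with rfl | hn
  · simp
  have hcs : (∑ i, ‖f (x i)‖) ^ 2 ≤ n * ∑ i, ‖f (x i)‖ ^ 2 := by
    simpa using sq_sum_le_card_mul_sum_sq (s := Finset.univ) (f := fun i => ‖f (x i)‖)
  rw [div_pow, div_le_div_iff₀ (by positivity) (by positivity)]
  nlinarith

lemma empNorm_apply_le_empNormVec (f : S → EuclideanSpace ℝ (Fin q)) (j : Fin q) :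
    empNorm x (fun s => f s j) ≤ empNormVec x f := by
  refine Real.sqrt_le_sqrt (div_le_div_of_nonneg_right (Finset.sum_le_sum fun i _ => ?_)
    n.cast_nonneg)
  rw [← sq_abs]
  exact pow_le_pow_left₀ (abs_nonneg _) (PiLp.norm_apply_le (f (x i)) j) 2

end Design

section NoiseProcess

variable {S : Type*} {n q r : ℕ} {x : Fin n → S} {Θ : Set (EuclideanSpace ℝ (Fin q))}
  {Φ : S → S → ℝ} {P : Submodule ℝ (S → ℝ)} {L a : ℝ}
  {f : S → EuclideanSpace ℝ (Fin q) → EuclideanSpace ℝ (Fin r)}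
  {θ θ' : S → EuclideanSpace ℝ (Fin q)}

/-- The vector of the values of `s ↦ f s (θ s)` at the design points. -/
def designValues (x : Fin n → S) (f : S → EuclideanSpace ℝ (Fin q) → EuclideanSpace ℝ (Fin r))
    (θ : S → EuclideanSpace ℝ (Fin q)) : PiLp 2 fun _ : Fin n => EuclideanSpace ℝ (Fin r) :=
  WithLp.toLp 2 fun i => f (x i) (θ (x i))

lemma norm_designValues_sub_le (hn : n ≠ 0) (hL : 0 ≤ L)
    (hf : ∀ s, ∀ u ∈ Θ, ∀ v ∈ Θ, ‖f s u - f s v‖ ≤ L * ‖u - v‖) (hθ : ∀ s, θ s ∈ Θ)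
    (hθ' : ∀ s, θ' s ∈ Θ) :
    ‖designValues x f θ - designValues x f θ'‖ ≤ L * √n * empNormVec x (θ - θ') := by
  calc ‖designValues x f θ - designValues x f θ'‖
      = √n * empNormVec x (fun s => f s (θ s) - f s (θ' s)) := by
        rw [empNormVec, ← Real.sqrt_mul n.cast_nonneg, mul_div_cancel₀ _ (Nat.cast_ne_zero.2 hn),
          PiLp.norm_eq_of_L2]
        rfl
    _ ≤ √n * (L * empNormVec x (θ - θ')) := by
        gcongr
        exact empNormVec_le_of_forall_norm_le hL fun s => hf s _ (hθ s) _ (hθ' s)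
    _ = L * √n * empNormVec x (θ - θ') := by ring

/-- The noise term `n⁻¹ ∑ ⟪f(x_i, θ(x_i)) - f(x_i, θ'(x_i)), e_i⟫` in the difference of the
least squares criteria of `θ` and `θ'` for the model `f`. -/
noncomputable def noiseIncrement (x : Fin n → S)
    (f : S → EuclideanSpace ℝ (Fin q) → EuclideanSpace ℝ (Fin r))
    (e : Fin n → EuclideanSpace ℝ (Fin r)) (θ θ' : S → EuclideanSpace ℝ (Fin q)) : ℝ :=
  (∑ i, inner ℝ (f (x i) (θ (x i)) - f (x i) (θ' (x i))) (e i)) / n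

lemma noiseIncrement_eq_inner (e : Fin n → EuclideanSpace ℝ (Fin r)) :
    noiseIncrement x f e θ θ' =
      inner ℝ (designValues x f θ - designValues x f θ') (WithLp.toLp 2 e) / n := by
  simp [noiseIncrement, designValues, PiLp.inner_apply]

/-- The size of `θ` relative to the center `θ'`: its native semi-norm or its empirical distance
to `θ'` in units of the scale `a`, whichever is larger. -/
noncomputable def relSize (Φ : S → S → ℝ) (P : Submodule ℝ (S → ℝ)) (x : Fin n → S) (a : ℝ)
    (θ' θ : S → EuclideanSpace ℝ (Fin q)) : ℝ :=
  max (nativeNormVec Φ P θ) (empNormVec x (θ - θ') / a)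

/-- The set of `θ ∈ 𝒩^Θ` of size at most `R` relative to `θ'`. The noise increments are controlled
over these sets, one dyadic radius `R = 2 ^ j` at a time. -/
def relBall (Φ : S → S → ℝ) (P : Submodule ℝ (S → ℝ)) (Θ : Set (EuclideanSpace ℝ (Fin q)))
    (x : Fin n → S) (a : ℝ) (θ' : S → EuclideanSpace ℝ (Fin q)) (R : ℝ) :
    Set (S → EuclideanSpace ℝ (Fin q)) :=
  {θ | θ ∈ nativeSpaceIn Φ P Θ ∧ relSize Φ P x a θ' θ ≤ R}

lemma norm_designValues_sub_le_of_mem_relBall {R : ℝ} (hn : n ≠ 0) (hL : 0 ≤ L) (ha : 0 < a)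
    (hf : ∀ s, ∀ u ∈ Θ, ∀ v ∈ Θ, ‖f s u - f s v‖ ≤ L * ‖u - v‖) (hθ' : ∀ s, θ' s ∈ Θ)
    (hθ : θ ∈ relBall Φ P Θ x a θ' R) :
    ‖designValues x f θ - designValues x f θ'‖ ≤ L * √n * a * R := by
  refine (norm_designValues_sub_le hn hL hf hθ.1.2 hθ').trans ?_
  rw [mul_assoc _ a, mul_comm a]
  gcongr
  exact (div_le_iff₀ ha).1 ((le_max_right _ _).trans hθ.2)

lemma EntropyCondition.exists_relBall_net {d : ℕ} {ν : ℝ} (hent : EntropyCondition Φ P d ν)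
    (Θ : Set (EuclideanSpace ℝ (Fin q))) (r : ℕ) :
    ∃ C, ∀ {n : ℕ}, n ≠ 0 → ∀ (x : Fin n → S) {L : ℝ}, 0 ≤ L →
      ∀ f : S → EuclideanSpace ℝ (Fin q) → EuclideanSpace ℝ (Fin r),
      (∀ s, ∀ u ∈ Θ, ∀ v ∈ Θ, ‖f s u - f s v‖ ≤ L * ‖u - v‖) →
      ∀ θ' {a R : ℝ}, 0 < a → 0 < R → ∀ k : ℕ,
      ∃ F : Finset (PiLp 2 fun _ : Fin n => EuclideanSpace ℝ (Fin r)),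
        (F.card : ℝ) ≤ Real.exp (C * (2 ^ k / a) ^ ((d : ℝ) / ν)) ∧
        ∀ θ ∈ relBall Φ P Θ x a θ' R, ∃ w ∈ F, ‖designValues x f θ - w‖ ≤
          L * √n * a * R / 2 ^ k := by
  classical
  obtain ⟨C, -, hnet⟩ := hent.exists_net q
  refine ⟨C, fun {n} hn x L hL f hf θ' a R ha hR k => ?_⟩
  obtain ⟨F, hFsub, hFcard, hF⟩ := hnet (R * a / 2 ^ k) R (by positivity) hR
    (relBall Φ P Θ x a θ' R) fun θ hθ j => ⟨hθ.1.1 j,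
      (nativeNorm_le_nativeNormVec θ j).trans ((le_max_left _ _).trans hθ.2)⟩
  refine ⟨F.image (designValues x f), ?_, fun θ hθ => ?_⟩
  · have hscale : R / (R * a / 2 ^ k) = 2 ^ k / a := by field_simp
    rw [← hscale]
    exact (Nat.cast_le.2 Finset.card_image_le).trans hFcard
  · obtain ⟨g, hg, hθg⟩ := hF θ hθ
    refine ⟨_, Finset.mem_image_of_mem _ hg,
      (norm_designValues_sub_le hn hL hf hθ.1.2 (hFsub hg).1.2).trans ?_⟩
    calc L * √n * empNormVec x (θ - g) ≤ L * √n * (R * a / 2 ^ k) := by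
          gcongr
          exact empNormVec_le_of_forall_norm_le_const (by positivity) hθg
      _ = L * √n * a * R / 2 ^ k := by ring

lemma two_pow_div_rpow_le {α : ℝ} (ha : 0 < a) (k : ℕ) :
    (2 ^ k / a) ^ α ≤ a⁻¹ ^ α * max 2 (2 ^ α) ^ k := by
  rw [div_eq_inv_mul, Real.mul_rpow (by positivity) (by positivity), ← Real.rpow_natCast_mul
    zero_le_two, mul_comm (k : ℝ), Real.rpow_mul_natCast zero_le_two]
  gcongr
  exact le_max_right _ _

lemma EntropyCondition.exists_relBall_chain {d : ℕ} {ν : ℝ} (hent : EntropyCondition Φ P d ν)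
    (Θ : Set (EuclideanSpace ℝ (Fin q))) (r : ℕ) :
    ∃ C, 1 ≤ C ∧ ∀ {n : ℕ}, n ≠ 0 → ∀ (x : Fin n → S) {L : ℝ}, 0 ≤ L →
      ∀ f : S → EuclideanSpace ℝ (Fin q) → EuclideanSpace ℝ (Fin r),
      (∀ s, ∀ u ∈ Θ, ∀ v ∈ Θ, ‖f s u - f s v‖ ≤ L * ‖u - v‖) →
      ∀ {θ'}, (∀ s, θ' s ∈ Θ) → ∀ {a : ℝ}, 0 < a → ∀ {R : ℝ}, 0 < R → ∀ k : ℕ,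
      ∃ F : Finset (PiLp 2 fun _ : Fin n => EuclideanSpace ℝ (Fin r)),
        (k = 0 → F = {designValues x f θ'}) ∧
        (F.card : ℝ) ≤ Real.exp (C * a⁻¹ ^ ((d : ℝ) / ν) * max 2 (2 ^ ((d : ℝ) / ν)) ^ k) ∧
        ∀ θ ∈ relBall Φ P Θ x a θ' R, ∃ w ∈ F, ‖designValues x f θ - w‖ ≤
          L * √n * a * R / 2 ^ k := by
  obtain ⟨C, hnet⟩ := hent.exists_relBall_net Θ r
  refine ⟨max C 1, le_max_right _ _, fun {n} hn x L hL f hf θ' hθ' a ha R hR k => ?_⟩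
  rcases eq_or_ne k 0 with rfl | hk
  · refine ⟨{designValues x f θ'}, fun _ => rfl, ?_,
      fun θ hθ => ⟨_, Finset.mem_singleton_self _, ?_⟩⟩
    · rw [Finset.card_singleton, Nat.cast_one]
      exact Real.one_le_exp (by positivity)
    · simpa using norm_designValues_sub_le_of_mem_relBall hn hL ha hf hθ' hθ
  · obtain ⟨F, hFcard, hF⟩ := hnet hn x hL f hf θ' ha hR k
    refine ⟨F, fun h => absurd h hk, hFcard.trans (Real.exp_le_exp.2 ?_), hF⟩
    rw [mul_assoc]
    exact mul_le_mul (le_max_left _ _) (two_pow_div_rpow_le ha k) (by positivity) (by positivity)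

lemma max_two_two_rpow_lt_four {α : ℝ} (hα : α < 2) : max (2 : ℝ) (2 ^ α) < 4 :=
  max_lt (by norm_num) ((Real.rpow_lt_rpow_of_exponent_lt one_lt_two hα).trans_eq (by norm_num))

lemma exists_le_two_pow_and_mul_sqrt_le {m : ℝ} (hm : 1 ≤ m) :
    ∃ j : ℕ, m ≤ 2 ^ j ∧ (2 : ℝ) ^ j * √(2 ^ j) ≤ 4 * (m * √m) := by
  obtain ⟨j, hj, hj'⟩ := exists_nat_pow_near hm one_lt_two
  refine ⟨j + 1, hj'.le, ?_⟩
  have hpow : (2 : ℝ) ^ (j + 1) ≤ 2 * m := by rw [pow_succ']; gcongr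
  calc (2 : ℝ) ^ (j + 1) * √(2 ^ (j + 1)) ≤ 2 * m * √(2 ^ 2 * m) := by
        gcongr
        linarith
    _ = 4 * (m * √m) := by
        rw [Real.sqrt_mul (by positivity), Real.sqrt_sq zero_le_two]
        ring

lemma sqrt_mul_mul_sqrt_le {N A B : ℝ} (ha : 0 ≤ a) (hN : 0 ≤ N) (hA : 0 ≤ A)
    (hB : B ≤ N * a ^ 2) : √N * a * √(A * B) ≤ √A * (N * a ^ 2) := by
  calc √N * a * √(A * B) ≤ √N * a * √(A * (N * a ^ 2)) := by gcongr
    _ = √A * (N * a ^ 2) := by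
        rw [Real.sqrt_mul hA, Real.sqrt_mul hN, Real.sqrt_sq ha]
        linear_combination √A * a ^ 2 * Real.mul_self_sqrt hN

variable {Ω : Type*} [MeasurableSpace Ω] {μ : Measure Ω} [IsFiniteMeasure μ] {σ : ℝ}

lemma EntropyCondition.exists_measure_noiseIncrement_gt_le {d : ℕ} {ν : ℝ}
    (hent : EntropyCondition Φ P d ν) (hν : (d : ℝ) / 2 < ν) (Θ : Set (EuclideanSpace ℝ (Fin q)))
    (r : ℕ) (hσ : 0 < σ) (hL : 0 ≤ L) {ε : ℝ} (hε : 0 < ε) :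
    ∃ K : ℝ, ∀ {n : ℕ}, n ≠ 0 → ∀ (x : Fin n → S)
      (e : Fin n → Ω → EuclideanSpace ℝ (Fin r)),
      IsSubGaussianVector (fun ω => WithLp.toLp 2 fun i => e i ω) σ μ →
      ∀ f : S → EuclideanSpace ℝ (Fin q) → EuclideanSpace ℝ (Fin r),
      (∀ s, ∀ u ∈ Θ, ∀ v ∈ Θ, ‖f s u - f s v‖ ≤ L * ‖u - v‖) → ∀ {θ'}, (∀ s, θ' s ∈ Θ) →
      ∀ {a : ℝ}, 0 < a → a ≤ 1 → a⁻¹ ^ ((d : ℝ) / ν) ≤ n * a ^ 2 →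
      μ {ω | ∃ θ ∈ nativeSpaceIn Φ P Θ, 1 ≤ relSize Φ P x a θ' θ ∧
        K * (relSize Φ P x a θ' θ * √(relSize Φ P x a θ' θ)) * a ^ 2 <
          |noiseIncrement x f (fun i => e i ω) θ θ'|} ≤ ENNReal.ofReal ε := by
  obtain ⟨C, hC, hchain⟩ := hent.exists_relBall_chain Θ r
  have hν0 : 0 < ν := lt_of_le_of_lt (by positivity) hν
  have hα : (d : ℝ) / ν < 2 := by rw [div_lt_iff₀ hν0]; linarith
  set h : ℝ := max 2 (2 ^ ((d : ℝ) / ν))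
  have hh4 : h < 4 := max_two_two_rpow_lt_four hα
  have hgap : 0 < 1 - √h / 2 := by
    rw [sub_pos, div_lt_one zero_lt_two, Real.sqrt_lt' zero_lt_two]
    linarith
  obtain ⟨Q, hQ, hQε⟩ : ∃ Q : ℝ, 10 ≤ Q ∧ 16 / Q ≤ ε := ⟨max 10 (16 / ε), le_max_left _ _,
    (div_le_comm₀ hε (by positivity)).1 (le_max_right _ _)⟩
  set κ : ℝ := σ * L / (1 - √h / 2) * √(8 * Q * C)
  refine ⟨4 * κ, fun {n} hn x e hξ f hf θ' hθ' a ha ha1 hbal => ?_⟩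
  have hN : 1 ≤ C * a⁻¹ ^ ((d : ℝ) / ν) := one_le_mul_of_one_le_of_one_le hC
    (Real.one_le_rpow ((one_le_inv₀ ha).2 ha1) (by positivity))
  choose F hF0 hFcard hF using fun j : ℕ =>
    hchain hn x hL f hf hθ' ha (R := 2 ^ j) (by positivity)
  refine (measure_mono ?_).trans ((hξ.measure_exists_peeled_gt_le hσ (le_max_left _ _) hh4 hN hQ
    (A := fun j => designValues x f '' relBall Φ P Θ x a θ' (2 ^ j)) (fun j => hF0 j 0 rfl) hFcard
    fun j => forall_mem_image.2 fun θ hθ k => hF j k θ hθ).trans (ENNReal.ofReal_le_ofReal hQε))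
  rintro ω ⟨θ, hθ, hm, hlt⟩
  set m := relSize Φ P x a θ' θ
  obtain ⟨j, hmj, hj⟩ := exists_le_two_pow_and_mul_sqrt_le hm
  refine ⟨j, _, mem_image_of_mem _ ⟨hθ, hmj⟩, ?_⟩
  rw [noiseIncrement_eq_inner, abs_div, Nat.abs_cast, lt_div_iff₀ (by positivity)] at hlt
  refine lt_of_le_of_lt ?_ hlt
  calc σ * (L * √n * a) * √(8 * Q * (C * a⁻¹ ^ ((d : ℝ) / ν))) / (1 - √h / 2) *
        (2 ^ j * √(2 ^ j))
      = σ * L / (1 - √h / 2) * (√n * a * √(8 * Q * C * a⁻¹ ^ ((d : ℝ) / ν))) *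
          (2 ^ j * √(2 ^ j)) := by
        rw [← mul_assoc (8 * Q)]
        ring
    _ ≤ σ * L / (1 - √h / 2) * (√(8 * Q * C) * (n * a ^ 2)) * (4 * (m * √m)) := by
        gcongr σ * L / (1 - √h / 2) * ?_ * ?_
        exact sqrt_mul_mul_sqrt_le ha.le n.cast_nonneg (by positivity) hbal
    _ = 4 * κ * (m * √m) * a ^ 2 * n := by ring

end NoiseProcess

/-! ### The basic inequality -/

section BasicInequality

lemma le_max_one_sq_of_mul_sq_le {κ B t : ℝ} (hκ : 0 < κ)
    (h : 1 ≤ t → κ * t ^ 2 ≤ B * (t * √t)) : t ≤ max 1 ((B / κ) ^ 2) := by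
  rcases le_total t 1 with ht | ht
  · exact le_max_of_le_left ht
  have hsq : √t ^ 2 = t := Real.sq_sqrt (zero_le_one.trans ht)
  have hsqrt : √t ≤ B / κ := by
    rw [le_div_iff₀ hκ]
    refine le_of_mul_le_mul_right ?_ (show 0 < t * √t by positivity)
    calc √t * κ * (t * √t) = κ * t * √t ^ 2 := by ring
      _ = κ * t ^ 2 := by rw [hsq]; ring
      _ ≤ B * (t * √t) := h ht
  refine le_max_of_le_right ?_
  rw [← hsq]
  gcongr

section ExcessLoss

variable {W : Type*} [NormedAddCommGroup W] [InnerProductSpace ℝ W] {p p' δ δ' : W}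

lemma norm_add_sub_sq_sub_norm_add_sub_sq (p p' δ δ' e : W) :
    ‖p + e - δ‖ ^ 2 - ‖p' + e - δ'‖ ^ 2 =
      ‖p‖ ^ 2 - ‖p'‖ ^ 2 - 2 * inner ℝ p (δ - δ') - 2 * inner ℝ (p - p') δ' +
        inner ℝ (δ - δ') (δ + δ') - 2 * inner ℝ ((δ - p) - (δ' - p')) e := by
  simp only [← real_inner_self_eq_norm_sq, inner_add_left, inner_add_right, inner_sub_left,
    inner_sub_right, real_inner_comm p e, real_inner_comm p' e, real_inner_comm p δ,
    real_inner_comm p' δ', real_inner_comm δ e, real_inner_comm δ' e, real_inner_comm δ δ']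
  ring

lemma norm_add_sub_sq_sub_norm_add_sub_sq_ge {A η D : ℝ} (hp : ‖p‖ ≤ A)
    (hpp' : ‖p - p'‖ ≤ A * D) (hδ : ‖δ‖ ≤ η) (hδ' : ‖δ'‖ ≤ η) (hδδ' : ‖δ - δ'‖ ≤ η * D) (e : W) :
    ‖p‖ ^ 2 - ‖p'‖ ^ 2 - 2 * (2 * A + η) * η * D - 2 * inner ℝ ((δ - p) - (δ' - p')) e ≤
      ‖p + e - δ‖ ^ 2 - ‖p' + e - δ'‖ ^ 2 := by
  have inner_le {v w : W} {b c : ℝ} (hv : ‖v‖ ≤ b) (hw : ‖w‖ ≤ c) : |inner ℝ v w| ≤ b * c :=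
    (abs_real_inner_le_norm v w).trans
      (mul_le_mul hv hw (norm_nonneg _) ((norm_nonneg _).trans hv))
  have hcross := (abs_le.1 (inner_le hp hδδ')).2
  have hshift := (abs_le.1 (inner_le hpp' hδ')).2
  have hsquare := (abs_le.1 (inner_le hδδ' (norm_add_le_of_le hδ hδ'))).1
  rw [norm_add_sub_sq_sub_norm_add_sub_sq]
  linarith

end ExcessLoss

variable {n q r : ℕ}

lemma empirical_excess_loss_ge {S : Type*} {x : Fin n → S} {Θ : Set (EuclideanSpace ℝ (Fin q))}
    {ζ : S → EuclideanSpace ℝ (Fin r)}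
    {f g : S → EuclideanSpace ℝ (Fin q) → EuclideanSpace ℝ (Fin r)} {A η ω₀ : ℝ}
    {θ θ' : S → EuclideanSpace ℝ (Fin q)} (hA : 0 ≤ A) (hη : 0 ≤ η)
    (hg : BoundedLipschitzOn A Θ fun s t => ζ s - g s t)
    (hfg : BoundedLipschitzOn η Θ fun s t => f s t - g s t) (hθ : ∀ s, θ s ∈ Θ)
    (hθ' : ∀ s, θ' s ∈ Θ)
    (hid : ∀ t ∈ Θ, ∀ s, ω₀ * ‖t - θ' s‖ ^ 2 ≤ ‖ζ s - g s t‖ ^ 2 - ‖ζ s - g s (θ' s)‖ ^ 2)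
    (e : Fin n → EuclideanSpace ℝ (Fin r)) :
    ω₀ * empNormVec x (θ - θ') ^ 2 - 2 * (2 * A + η) * η * empNormVec x (θ - θ') -
        2 * noiseIncrement x f e θ θ' ≤
      (∑ i, ‖ζ (x i) + e i - f (x i) (θ (x i))‖ ^ 2) / n -
        (∑ i, ‖ζ (x i) + e i - f (x i) (θ' (x i))‖ ^ 2) / n := by
  have hpoint : ∀ (s : S) (e : EuclideanSpace ℝ (Fin r)),
      ω₀ * ‖(θ - θ') s‖ ^ 2 - 2 * (2 * A + η) * η * ‖(θ - θ') s‖ -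
        2 * inner ℝ (f s (θ s) - f s (θ' s)) e ≤
      ‖ζ s + e - f s (θ s)‖ ^ 2 - ‖ζ s + e - f s (θ' s)‖ ^ 2 := fun s e => by
    have hexc := norm_add_sub_sq_sub_norm_add_sub_sq_ge (hg.norm_le s _ (hθ s))
      (hg.norm_sub_le s _ (hθ s) _ (hθ' s)) (hfg.norm_le s _ (hθ s)) (hfg.norm_le s _ (hθ' s))
      (hfg.norm_sub_le s _ (hθ s) _ (hθ' s)) e
    have hres : ∀ t, ζ s - g s t + e - (f s t - g s t) = ζ s + e - f s t := fun t => by abel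
    have hinc : f s (θ s) - g s (θ s) - (ζ s - g s (θ s)) -
        (f s (θ' s) - g s (θ' s) - (ζ s - g s (θ' s))) = f s (θ s) - f s (θ' s) := by abel
    rw [hres, hres, hinc] at hexc
    rw [Pi.sub_apply]
    linarith [hid _ (hθ s) s]
  calc ω₀ * empNormVec x (θ - θ') ^ 2 - 2 * (2 * A + η) * η * empNormVec x (θ - θ') -
        2 * noiseIncrement x f e θ θ'
      ≤ ω₀ * empNormVec x (θ - θ') ^ 2 - 2 * (2 * A + η) * η * ((∑ i, ‖(θ - θ') (x i)‖) / (n : ℝ)) -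
        2 * noiseIncrement x f e θ θ' := by
        gcongr
        exact sum_norm_div_le_empNormVec _
    _ = (∑ i, (ω₀ * ‖(θ - θ') (x i)‖ ^ 2 - 2 * (2 * A + η) * η * ‖(θ - θ') (x i)‖ -
        2 * inner ℝ (f (x i) (θ (x i)) - f (x i) (θ' (x i))) (e i))) / (n : ℝ) := by
        simp only [Finset.sum_sub_distrib, ← Finset.mul_sum, empNormVec_sq, noiseIncrement]
        ring
    _ ≤ (∑ i, (‖ζ (x i) + e i - f (x i) (θ (x i))‖ ^ 2 -
        ‖ζ (x i) + e i - f (x i) (θ' (x i))‖ ^ 2)) / (n : ℝ) := by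
        gcongr (∑ i, ?_) / (n : ℝ) with i
        exact hpoint _ _
    _ = (∑ i, ‖ζ (x i) + e i - f (x i) (θ (x i))‖ ^ 2) / (n : ℝ) -
        (∑ i, ‖ζ (x i) + e i - f (x i) (θ' (x i))‖ ^ 2) / (n : ℝ) := by
        rw [Finset.sum_sub_distrib, sub_div]

variable {d : ℕ} {X : Set (EuclideanSpace ℝ (Fin d))} {Φ : X → X → ℝ} {P : Submodule ℝ (X → ℝ)}
  {x : Fin n → X} {Θ : Set (EuclideanSpace ℝ (Fin q))} {ζ : X → EuclideanSpace ℝ (Fin r)}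
  {f g : EuclideanSpace ℝ (Fin d) × EuclideanSpace ℝ (Fin q) → EuclideanSpace ℝ (Fin r)}
  {e : Fin n → EuclideanSpace ℝ (Fin r)} {lam A ω₀ : ℝ}
  {θ θ' : X → EuclideanSpace ℝ (Fin q)}

lemma IsEstimate.basic_inequality {η : ℝ}
    (hest : IsEstimate Φ P Θ x (fun i => ζ (x i) + e i) f lam θ) (hA : 0 ≤ A) (hη : 0 ≤ η)
    (hg : BoundedLipschitzOn A Θ fun (z : X) t => ζ z - g (z, t))
    (hfg : BoundedLipschitzOn η Θ fun (z : X) t => f (z, t) - g (z, t))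
    (hθ' : θ' ∈ nativeSpaceIn Φ P Θ)
    (hid : ∀ t ∈ Θ, ∀ z : X,
      ω₀ * ‖t - θ' z‖ ^ 2 ≤ ‖ζ z - g (z, t)‖ ^ 2 - ‖ζ z - g (z, θ' z)‖ ^ 2) :
    ω₀ * empNormVec x (θ - θ') ^ 2 + lam * nativeNormVec Φ P θ ^ 2 ≤
      lam * nativeNormVec Φ P θ' ^ 2 + 2 * (2 * A + η) * η * empNormVec x (θ - θ') +
        2 * |noiseIncrement x (fun z t => f (z, t)) e θ θ'| := by
  have hexcess := empirical_excess_loss_ge (x := x) hA hη hg hfg hest.1.2 hθ'.2 hid e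
  have hmin : criterion Φ P x (fun i => ζ (x i) + e i) f lam θ ≤
      criterion Φ P x (fun i => ζ (x i) + e i) f lam θ' := hest.2 hθ'
  simp only [criterion, ← nativeNormVec_sq, one_div_mul_eq_div] at hmin
  linarith [le_abs_self (noiseIncrement x (fun z t => f (z, t)) e θ θ')]

variable {a : ℝ}

lemma min_mul_relSize_sq_mul_sq_le {S : Type*} {Φ : S → S → ℝ} {P : Submodule ℝ (S → ℝ)}
    {x : Fin n → S} {θ θ' : S → EuclideanSpace ℝ (Fin q)} {b c : ℝ} (hb : 0 ≤ b) (hc : 0 ≤ c)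
    (ha : 0 < a) :
    min b c * relSize Φ P x a θ' θ ^ 2 * a ^ 2 ≤
      b * empNormVec x (θ - θ') ^ 2 + c * a ^ 2 * nativeNormVec Φ P θ ^ 2 := by
  rcases max_choice (nativeNormVec Φ P θ) (empNormVec x (θ - θ') / a) with h | h <;>
    rw [relSize, h]
  · calc min b c * nativeNormVec Φ P θ ^ 2 * a ^ 2
        ≤ c * nativeNormVec Φ P θ ^ 2 * a ^ 2 := by
          gcongr
          exact min_le_right b c
      _ ≤ b * empNormVec x (θ - θ') ^ 2 + c * a ^ 2 * nativeNormVec Φ P θ ^ 2 := by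
          rw [mul_right_comm]
          exact le_add_of_nonneg_left (by positivity)
  · calc min b c * (empNormVec x (θ - θ') / a) ^ 2 * a ^ 2
        = min b c * empNormVec x (θ - θ') ^ 2 := by field_simp
      _ ≤ b * empNormVec x (θ - θ') ^ 2 := by
          gcongr
          exact min_le_left b c
      _ ≤ b * empNormVec x (θ - θ') ^ 2 + c * a ^ 2 * nativeNormVec Φ P θ ^ 2 :=
          le_add_of_nonneg_right (by positivity)

lemma IsEstimate.relSize_le {C K c₁ c₂ : ℝ}
    (hest : IsEstimate Φ P Θ x (fun i => ζ (x i) + e i) f lam θ) (hA : 0 ≤ A) (hC : 0 ≤ C)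
    (ha : 0 < a) (ha1 : a ≤ 1) (hω₀ : 0 < ω₀) (hc₁ : 0 < c₁) (hlam₁ : c₁ * a ^ 2 ≤ lam)
    (hc₂ : 0 ≤ c₂) (hlam₂ : lam ≤ c₂ * a ^ 2)
    (hg : BoundedLipschitzOn A Θ fun (z : X) t => ζ z - g (z, t))
    (hfg : BoundedLipschitzOn (C * a) Θ fun (z : X) t => f (z, t) - g (z, t))
    (hθ' : θ' ∈ nativeSpaceIn Φ P Θ)
    (hid : ∀ t ∈ Θ, ∀ z : X,
      ω₀ * ‖t - θ' z‖ ^ 2 ≤ ‖ζ z - g (z, t)‖ ^ 2 - ‖ζ z - g (z, θ' z)‖ ^ 2)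
    (hnoise : 1 ≤ relSize Φ P x a θ' θ → |noiseIncrement x (fun z t => f (z, t)) e θ θ'| ≤
      K * (relSize Φ P x a θ' θ * √(relSize Φ P x a θ' θ)) * a ^ 2) :
    relSize Φ P x a θ' θ ≤ max 1
      (((c₂ * nativeNormVec Φ P θ' ^ 2 + 2 * (2 * A + C) * C + 2 * K) / min ω₀ c₁) ^ 2) := by
  refine le_max_one_sq_of_mul_sq_le (lt_min hω₀ hc₁) fun ht => ?_
  have hbasic := hest.basic_inequality hA (by positivity) hg hfg hθ' hid
  have hdist : empNormVec x (θ - θ') ≤ relSize Φ P x a θ' θ * a :=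
    (div_le_iff₀ ha).1 (le_max_right _ _)
  specialize hnoise ht
  set t := relSize Φ P x a θ' θ
  have hsqrt : 1 ≤ √t := Real.one_le_sqrt.2 ht
  refine le_of_mul_le_mul_right ?_ (pow_pos ha 2)
  calc min ω₀ c₁ * t ^ 2 * a ^ 2
      ≤ ω₀ * empNormVec x (θ - θ') ^ 2 + c₁ * a ^ 2 * nativeNormVec Φ P θ ^ 2 :=
        min_mul_relSize_sq_mul_sq_le hω₀.le hc₁.le ha
    _ ≤ ω₀ * empNormVec x (θ - θ') ^ 2 + lam * nativeNormVec Φ P θ ^ 2 := by gcongr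
    _ ≤ lam * nativeNormVec Φ P θ' ^ 2 + 2 * (2 * A + C * a) * (C * a) * empNormVec x (θ - θ') +
        2 * |noiseIncrement x (fun z t => f (z, t)) e θ θ'| := hbasic
    _ ≤ c₂ * a ^ 2 * nativeNormVec Φ P θ' ^ 2 + 2 * (2 * A + C) * (C * a) * (t * a) +
        2 * (K * (t * √t) * a ^ 2) := by
        gcongr
        · exact empNormVec_nonneg _
        · exact mul_le_of_le_one_right hC ha1
    _ = (c₂ * nativeNormVec Φ P θ' ^ 2 * 1 + 2 * (2 * A + C) * C * (t * 1) +
        2 * K * (t * √t)) * a ^ 2 := by ring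
    _ ≤ (c₂ * nativeNormVec Φ P θ' ^ 2 * (t * √t) + 2 * (2 * A + C) * C * (t * √t) +
        2 * K * (t * √t)) * a ^ 2 := by
        gcongr
        exact one_le_mul_of_one_le_of_one_le ht hsqrt
    _ = (c₂ * nativeNormVec Φ P θ' ^ 2 + 2 * (2 * A + C) * C + 2 * K) * (t * √t) * a ^ 2 := by
        ring

end BasicInequality

section L2Bound

variable {d n q : ℕ} {X : Set (EuclideanSpace ℝ (Fin d))} {Φ : X → X → ℝ}
  {P : Submodule ℝ (X → ℝ)}

lemma l2NormVec_le_of_forall_l2Norm_le {f : X → EuclideanSpace ℝ (Fin q)} {b : ℝ≥0∞}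
    (hf : ∀ j, l2Norm (fun s => f s j) ≤ b) : l2NormVec f ≤ q * b := by
  calc l2NormVec f ≤ ((q * b) ^ 2) ^ (1 / 2 : ℝ) := by
        refine ENNReal.rpow_le_rpow ?_ (by norm_num)
        calc ∑ j, l2Norm (fun s => f s j) ^ 2 ≤ ∑ _j : Fin q, b ^ 2 := by
              gcongr with j
              exact hf j
          _ = q * b ^ 2 := by simp
          _ ≤ (q * b) ^ 2 := by
              rw [mul_pow]
              gcongr
              exact_mod_cast Nat.le_self_pow two_ne_zero q
    _ = q * b := by
        rw [← ENNReal.rpow_natCast, ← ENNReal.rpow_mul]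
        norm_num

lemma l2NormVec_sub_le_of_relSize_le {x : Fin n → X} {C a M : ℝ} (hC : 0 ≤ C) (ha : 0 < a)
    (hx : ∀ f ∈ nativeSpace Φ P,
      l2Norm f ≤ ENNReal.ofReal (C * (empNorm x f + a * nativeNorm Φ P f)))
    {θ θ' : X → EuclideanSpace ℝ (Fin q)} (hθ : ∀ j, (fun s => θ s j) ∈ nativeSpace Φ P)
    (hθ' : ∀ j, (fun s => θ' s j) ∈ nativeSpace Φ P) (hM : relSize Φ P x a θ' θ ≤ M) :
    l2NormVec (fun s => θ s - θ' s) ≤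
      ENNReal.ofReal (q * (C * (2 * M + nativeNormVec Φ P θ')) * a) := by
  have hcomp : ∀ j, l2Norm (fun s => (θ s - θ' s) j) ≤
      ENNReal.ofReal (C * (2 * M + nativeNormVec Φ P θ') * a) := fun j => by
    refine (hx _ (sub_mem_nativeSpace (hθ j) (hθ' j))).trans (ENNReal.ofReal_le_ofReal ?_)
    have hemp : empNorm x (fun s => θ s j - θ' s j) ≤ M * a :=
      (empNorm_apply_le_empNormVec (θ - θ') j).trans
        ((div_le_iff₀ ha).1 ((le_max_right _ _).trans hM))
    have hnat : nativeNorm Φ P (fun s => θ s j - θ' s j) ≤ M + nativeNormVec Φ P θ' :=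
      (nativeNorm_sub_le (hθ j) (hθ' j)).trans (add_le_add
        ((nativeNorm_le_nativeNormVec θ j).trans ((le_max_left _ _).trans hM))
        (nativeNorm_le_nativeNormVec θ' j))
    calc C * (empNorm x (fun s => θ s j - θ' s j) +
          a * nativeNorm Φ P (fun s => θ s j - θ' s j))
        ≤ C * (M * a + a * (M + nativeNormVec Φ P θ')) := by gcongr
      _ = C * (2 * M + nativeNormVec Φ P θ') * a := by ring
  refine (l2NormVec_le_of_forall_l2Norm_le hcomp).trans_eq ?_
  rw [← ENNReal.ofReal_natCast, ← ENNReal.ofReal_mul q.cast_nonneg, mul_assoc (q : ℝ)]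

end L2Bound

/-! ### Rates of convergence -/

section Rate

variable {ν : ℝ} {n : ℕ} (d : ℕ)

lemma rate_pos (ν : ℝ) (hn : n ≠ 0) : 0 < rate ν d n := Real.rpow_pos_of_pos (by positivity) _

lemma rate_le_one (hν : 0 ≤ ν) (hn : n ≠ 0) : rate ν d n ≤ 1 :=
  Real.rpow_le_one_of_one_le_of_nonpos (Nat.one_le_cast.2 (Nat.one_le_iff_ne_zero.2 hn))
    (neg_nonpos.2 (by positivity))

lemma rate_sq (ν : ℝ) (n : ℕ) : rate ν d n ^ 2 = (n : ℝ) ^ (-(2 * ν / (2 * ν + d))) := by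
  rw [rate, ← Real.rpow_mul_natCast n.cast_nonneg]
  congr 1
  push_cast
  ring

lemma inv_rate_rpow_eq_mul_rate_sq (hν : 0 < ν) (hn : n ≠ 0) :
    (rate ν d n)⁻¹ ^ ((d : ℝ) / ν) = n * rate ν d n ^ 2 := by
  have hn0 : (0 : ℝ) < n := by positivity
  rw [rate_sq, rate, ← Real.rpow_neg hn0.le, ← Real.rpow_mul hn0.le]
  nth_rewrite 2 [← Real.rpow_one (n : ℝ)]
  rw [← Real.rpow_add hn0]
  congr 1
  field_simp
  ring

variable {d} {lam : ℕ → ℝ}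

lemma exists_eventually_le_mul_rate_sq
    (hlam : lam =O[atTop] fun n : ℕ => (n : ℝ) ^ (-(2 * ν / (2 * ν + d)))) :
    ∃ c, 0 ≤ c ∧ ∀ᶠ n in atTop, lam n ≤ c * rate ν d n ^ 2 := by
  obtain ⟨c, hc, hbound⟩ := hlam.exists_nonneg
  refine ⟨c, hc, hbound.bound.mono fun n hn => ?_⟩
  rw [← rate_sq, Real.norm_of_nonneg (sq_nonneg _)] at hn
  exact (Real.le_norm_self _).trans hn

lemma exists_eventually_mul_rate_sq_le (hpos : ∀ n, 1 ≤ n → 0 < lam n)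
    (hlam : (fun n => (lam n)⁻¹) =O[atTop] fun n : ℕ => (n : ℝ) ^ (2 * ν / (2 * ν + d))) :
    ∃ c, 0 < c ∧ ∀ᶠ n in atTop, c * rate ν d n ^ 2 ≤ lam n := by
  obtain ⟨c, hc, hbound⟩ := hlam.exists_pos
  refine ⟨c⁻¹, inv_pos.2 hc, ?_⟩
  filter_upwards [hbound.bound, eventually_ge_atTop 1] with n hn hn1
  rw [← neg_neg (2 * ν / (2 * ν + d)), Real.rpow_neg n.cast_nonneg, ← rate_sq, norm_inv, norm_inv,
    Real.norm_of_nonneg (hpos n hn1).le, Real.norm_of_nonneg (sq_nonneg _)] at hn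
  have hrate := rate_pos d ν (Nat.one_le_iff_ne_zero.1 hn1)
  have hlam_n := hpos n hn1
  rw [inv_le_comm₀ hlam_n (by positivity), mul_inv, inv_inv] at hn
  exact hn

end Rate

section Convergence

variable {Ω : Type*} [MeasurableSpace Ω] {μ : Measure Ω}

lemma IsBigOp.of_forall_ae_le {Y : ℕ → Ω → ℝ≥0∞} {Z : ℕ → Ω → ℝ} {a : ℕ → ℝ}
    (hZ : IsBigOp μ (fun n ω => ENNReal.ofReal (Z n ω)) fun _ => 1)
    (h : ∀ M, 0 < M → ∃ C, 0 < C ∧ ∀ᶠ n in atTop, ∀ᵐ ω ∂μ,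
      Z n ω ≤ M → Y n ω ≤ ENNReal.ofReal (C * a n)) : IsBigOp μ Y a := by
  intro ε hε
  obtain ⟨M, hM, hZM⟩ := hZ ε hε
  obtain ⟨C, hC, hYC⟩ := h M hM
  refine ⟨C, hC, ?_⟩
  filter_upwards [hZM, hYC] with n hZn hYn
  refine (measure_mono_ae ?_).trans hZn
  filter_upwards [hYn] with ω hω hlt
  have hMZ : M < Z n ω := lt_of_not_ge fun hle => hlt.not_ge (hω hle)
  change ENNReal.ofReal (M * 1) < ENNReal.ofReal (Z n ω)
  rwa [mul_one, ENNReal.ofReal_lt_ofReal_iff_of_nonneg hM.le]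

variable {d q r : ℕ} {X : Set (EuclideanSpace ℝ (Fin d))} {Θ : Set (EuclideanSpace ℝ (Fin q))}
  {Φ : X → X → ℝ} {P : Submodule ℝ (X → ℝ)} {ζ : X → EuclideanSpace ℝ (Fin r)}
  {y : EuclideanSpace ℝ (Fin d) × EuclideanSpace ℝ (Fin q) → EuclideanSpace ℝ (Fin r)}
  {yhat : ℕ → EuclideanSpace ℝ (Fin d) × EuclideanSpace ℝ (Fin q) → EuclideanSpace ℝ (Fin r)}
  {ν σ : ℝ} {x : (n : ℕ) → Fin n → X} {e : (n : ℕ) → Fin n → Ω → EuclideanSpace ℝ (Fin r)}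
  {θstar : X → EuclideanSpace ℝ (Fin q)} {lam : ℕ → ℝ} {θhat : ℕ → Ω → X → EuclideanSpace ℝ (Fin q)}

lemma NoiseCondition.isSubGaussianVector_toLp (he : NoiseCondition μ σ e) (n : ℕ) :
    IsSubGaussianVector (fun ω => WithLp.toLp 2 fun i => e n i ω) σ μ :=
  .toLp (he.indep n) fun i => (he.subGaussian n i).isSubGaussianVector (he.mean_zero n i)

lemma BoundedLipschitzOn.of_sub_mul_rate {f g : X → EuclideanSpace ℝ (Fin q) →
    EuclideanSpace ℝ (Fin r)} {B C : ℝ} {n : ℕ} (hg : BoundedLipschitzOn B Θ g) (hC : 0 ≤ C)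
    (hν : 0 ≤ ν) (hn : n ≠ 0)
    (hfg : BoundedLipschitzOn (C * rate ν d n) Θ fun z t => f z t - g z t) :
    BoundedLipschitzOn (C + B) Θ f := by
  simpa using (hfg.mono (mul_le_of_le_one_right hC (rate_le_one d hν hn))).add hg

lemma isBigOp_relSize [IsFiniteMeasure μ] {A B C ω₀ c₁ c₂ : ℝ} (hν : (d : ℝ) / 2 < ν) (hσ : 0 < σ)
    (he : NoiseCondition μ σ e) (hent : EntropyCondition Φ P d ν) (hA : 0 ≤ A)
    (hζ : ∀ z, ‖ζ z‖ ≤ A) (hB : 0 ≤ B) (hy : BoundedLipschitzOn B Θ fun (z : X) t => y (z, t))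
    (hC : 0 ≤ C) (hyhat : ∀ᶠ n in atTop,
      BoundedLipschitzOn (C * rate ν d n) Θ fun (z : X) t => yhat n (z, t) - y (z, t))
    (hθstar : θstar ∈ nativeSpaceIn Φ P Θ) (hω₀ : 0 < ω₀)
    (hid : ∀ t ∈ Θ, ∀ z : X,
      ω₀ * ‖t - θstar z‖ ^ 2 ≤ ‖ζ z - y (z, t)‖ ^ 2 - ‖ζ z - y (z, θstar z)‖ ^ 2)
    (hc₁ : 0 < c₁) (hlam₁ : ∀ᶠ n in atTop, c₁ * rate ν d n ^ 2 ≤ lam n) (hc₂ : 0 ≤ c₂)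
    (hlam₂ : ∀ᶠ n in atTop, lam n ≤ c₂ * rate ν d n ^ 2)
    (hθhat : ∀ n, 1 ≤ n → ∀ᵐ ω ∂μ,
      IsEstimate Φ P Θ (x n) (fun i => ζ (x n i) + e n i ω) (yhat n) (lam n) (θhat n ω)) :
    IsBigOp μ (fun n ω => ENNReal.ofReal (relSize Φ P (x n) (rate ν d n) θstar (θhat n ω)))
      fun _ => 1 := by
  intro ε hε
  have hν0 : 0 < ν := lt_of_le_of_lt (by positivity) hν
  obtain ⟨K, hK⟩ := hent.exists_measure_noiseIncrement_gt_le (μ := μ) hν Θ r hσ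
    (add_nonneg hC hB) hε
  refine ⟨max 1 (((c₂ * nativeNormVec Φ P θstar ^ 2 + 2 * (2 * (A + B) + C) * C + 2 * K) /
    min ω₀ c₁) ^ 2), lt_max_of_lt_left one_pos, ?_⟩
  filter_upwards [hyhat, hlam₁, hlam₂, eventually_ge_atTop 1] with n hyhat_n hlam₁_n hlam₂_n hn
  have hn0 : n ≠ 0 := Nat.one_le_iff_ne_zero.1 hn
  refine (measure_mono_ae ?_).trans (hK hn0 (x n) (e n) (he.isSubGaussianVector_toLp n)
    (fun z t => yhat n (z, t)) (hy.of_sub_mul_rate hC hν0.le hn0 hyhat_n).norm_sub_le hθstar.2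
    (rate_pos d ν hn0) (rate_le_one d hν0.le hn0) (inv_rate_rpow_eq_mul_rate_sq d hν0 hn0).le)
  filter_upwards [hθhat n hn] with ω hest hlt
  by_contra hgood
  refine hlt.not_ge (ENNReal.ofReal_le_ofReal ?_)
  rw [mul_one]
  exact hest.relSize_le (add_nonneg hA hB) hC (rate_pos d ν hn0) (rate_le_one d hν0.le hn0) hω₀
    hc₁ hlam₁_n hc₂ hlam₂_n (hy.const_sub hζ hA) hyhat_n hθstar hid
    (K := K) fun ht => not_lt.1 fun hnoise => hgood ⟨_, hest.1, ht, hnoise⟩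

lemma isBigOp_nativeNormVec {a : ℕ → ℝ}
    (hsize : IsBigOp μ (fun n ω => ENNReal.ofReal (relSize Φ P (x n) (a n) θstar (θhat n ω)))
      fun _ => 1) :
    IsBigOp μ (fun n ω => ENNReal.ofReal (nativeNormVec Φ P (θhat n ω))) fun _ => 1 :=
  hsize.of_forall_ae_le fun M hM => ⟨M, hM, .of_forall fun n => .of_forall fun ω hle => by
    rw [mul_one]
    exact ENNReal.ofReal_le_ofReal ((le_max_left _ _).trans hle)⟩

lemma DesignCondition.isBigOp_l2NormVec_sub (hx : DesignCondition Φ P ν x)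
    (hθstar : ∀ j, (fun s => θstar s j) ∈ nativeSpace Φ P)
    (hθhat : ∀ n, 1 ≤ n → ∀ᵐ ω ∂μ, ∀ j, (fun s => θhat n ω s j) ∈ nativeSpace Φ P)
    (hsize : IsBigOp μ
      (fun n ω => ENNReal.ofReal (relSize Φ P (x n) (rate ν d n) θstar (θhat n ω))) fun _ => 1) :
    IsBigOp μ (fun n ω => l2NormVec fun s => θhat n ω s - θstar s) (rate ν d) := by
  obtain ⟨C, hC⟩ := hx
  have hstar := nativeNormVec_nonneg (Φ := Φ) (P := P) θstar
  refine hsize.of_forall_ae_le fun M hM =>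
    ⟨q * (max C 0 * (2 * M + nativeNormVec Φ P θstar)) + 1, by positivity, ?_⟩
  filter_upwards [eventually_ge_atTop 1] with n hn
  filter_upwards [hθhat n hn] with ω hω hle
  have hdesign : ∀ f ∈ nativeSpace Φ P, l2Norm f ≤ ENNReal.ofReal
      (max C 0 * (empNorm (x n) f + rate ν d n * nativeNorm Φ P f)) := fun f hf =>
    (hC n hn f hf).trans (ENNReal.ofReal_le_ofReal (mul_le_mul_of_nonneg_right (le_max_left C 0)
      (add_nonneg (Real.sqrt_nonneg _) (mul_nonneg (rate_nonneg ν d n) (nativeNorm_nonneg f)))))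
  refine (l2NormVec_sub_le_of_relSize_le (le_max_right C 0) (rate_pos d ν
    (Nat.one_le_iff_ne_zero.1 hn)) hdesign hω hθstar hle).trans (ENNReal.ofReal_le_ofReal ?_)
  exact mul_le_mul_of_nonneg_right (le_add_of_nonneg_right zero_le_one) (rate_nonneg ν d n)

end Convergence

end FunCalib

theorem theorem4_general {Ω : Type*} [MeasurableSpace Ω] (μ : Measure Ω) [IsProbabilityMeasure μ]
    (d q r : ℕ)
    (X : Set (EuclideanSpace ℝ (Fin d))) (hXc : IsCompact X)
    (Θ : Set (EuclideanSpace ℝ (Fin q))) (hΘc : IsCompact Θ)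
    (hΘ : FunCalib.LocallyQuasiconvex Θ)
    (Φ : X → X → ℝ) (P : Submodule ℝ (X → ℝ))
    (_hΦ : ∀ c, FunCalib.Annihilates P c → 0 ≤ FunCalib.quadForm Φ c)
    (ζ : X → EuclideanSpace ℝ (Fin r)) (hζ : ∃ M : ℝ, ∀ x, ‖ζ x‖ ≤ M)
    (y : EuclideanSpace ℝ (Fin d) × EuclideanSpace ℝ (Fin q) → EuclideanSpace ℝ (Fin r))
    (yhat : ℕ → EuclideanSpace ℝ (Fin d) × EuclideanSpace ℝ (Fin q) →
      EuclideanSpace ℝ (Fin r))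
    (ν : ℝ) (hν : (d : ℝ) / 2 < ν)
    (x : (n : ℕ) → Fin n → X) (hx : FunCalib.DesignCondition Φ P ν x)
    (σ : ℝ) (hσ : 0 < σ) (e : (n : ℕ) → Fin n → Ω → EuclideanSpace ℝ (Fin r))
    (he : FunCalib.NoiseCondition μ σ e)
    (hy : ContDiffOn ℝ 1 y (X ×ˢ Θ))
    (hent : FunCalib.EntropyCondition Φ P d ν)
    (hemu : FunCalib.EmulatorCondition (X ×ˢ Θ) ν y yhat)
    (θstar : X → EuclideanSpace ℝ (Fin q))
    (hθstar : θstar ∈ FunCalib.nativeSpaceIn Φ P Θ)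
    (hid : FunCalib.IdentifiabilityCondition Θ ζ y θstar)
    (lam : ℕ → ℝ) (hlam_pos : ∀ n, 1 ≤ n → 0 < lam n)
    (hlam : lam =O[atTop] fun n : ℕ => (n : ℝ) ^ (-(2 * ν / (2 * ν + d))))
    (hlam_inv : (fun n => (lam n)⁻¹) =O[atTop] fun n : ℕ => (n : ℝ) ^ (2 * ν / (2 * ν + d)))
    (θhat : ℕ → Ω → X → EuclideanSpace ℝ (Fin q))
    (hθhat : ∀ n, 1 ≤ n → ∀ᵐ ω ∂μ,
      FunCalib.IsEstimate Φ P Θ (x n) (fun i => ζ (x n i) + e n i ω) (yhat n) (lam n)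
        (θhat n ω)) :
    FunCalib.IsBigOp μ (fun n ω => FunCalib.l2NormVec fun s => θhat n ω s - θstar s)
        (fun n => (n : ℝ) ^ (-(ν / (2 * ν + d)))) ∧
      FunCalib.IsBigOp μ
        (fun n ω => ENNReal.ofReal (FunCalib.nativeNormVec Φ P (θhat n ω)))
        (fun _ => 1) := by
  obtain ⟨A, hA⟩ := hζ
  obtain ⟨B, hB, hyB⟩ := FunCalib.exists_boundedLipschitzOn_of_contDiffOn hXc hΘc hΘ hy
  obtain ⟨C, hC, hyhatC⟩ := hemu.exists_boundedLipschitzOn hΘ hy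
  obtain ⟨ω₀, hω₀, hmargin⟩ := hid.2
  obtain ⟨c₁, hc₁, hlam₁⟩ := FunCalib.exists_eventually_mul_rate_sq_le hlam_pos hlam_inv
  obtain ⟨c₂, hc₂, hlam₂⟩ := FunCalib.exists_eventually_le_mul_rate_sq hlam
  have hsize := FunCalib.isBigOp_relSize hν hσ he hent (le_max_right A 0)
    (fun z => (hA z).trans (le_max_left A 0)) hB hyB hC hyhatC hθstar hω₀ hmargin hc₁ hlam₁ hc₂
    hlam₂ hθhat
  exact ⟨hx.isBigOp_l2NormVec_sub hθstar.1 (fun n hn => (hθhat n hn).mono fun ω h => h.1.1) hsize,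
    FunCalib.isBigOp_nativeNormVec hsize⟩

theorem theorem4 {Ω : Type*} [MeasurableSpace Ω] (μ : Measure Ω) [IsProbabilityMeasure μ]
    (d q r : ℕ) (hd : 1 ≤ d)
    -- the input domain and the parameter set
    (X : Set (EuclideanSpace ℝ (Fin d))) (hXc : IsCompact X) (hXconv : Convex ℝ X)
    (Θ : Set (EuclideanSpace ℝ (Fin q))) (hΘc : IsCompact Θ)
    (hΘ : FunCalib.LocallyQuasiconvex Θ)
    -- the kernel and its native space
    (Φ : X → X → ℝ) (P : Submodule ℝ (X → ℝ)) (hΦ : FunCalib.IsCondPosDef Φ P)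
    -- the physical response, the computer model and its emulators
    (ζ : X → EuclideanSpace ℝ (Fin r)) (hζ : ∃ M : ℝ, ∀ x, ‖ζ x‖ ≤ M)
    (y : EuclideanSpace ℝ (Fin d) × EuclideanSpace ℝ (Fin q) → EuclideanSpace ℝ (Fin r))
    (yhat : ℕ → EuclideanSpace ℝ (Fin d) × EuclideanSpace ℝ (Fin q) →
      EuclideanSpace ℝ (Fin r))
    (ν : ℝ) (hν : (d : ℝ) / 2 < ν)
    -- fixed design and noise
    (x : (n : ℕ) → Fin n → X) (hx : FunCalib.DesignCondition Φ P ν x)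
    (σ : ℝ) (hσ : 0 < σ) (e : (n : ℕ) → Fin n → Ω → EuclideanSpace ℝ (Fin r))
    (he : FunCalib.NoiseCondition μ σ e)
    -- smoothness of the computer model
    (hy : ContDiffOn ℝ 2 y (X ×ˢ Θ))
    -- entropy of the native space
    (hent : FunCalib.EntropyCondition Φ P d ν)
    -- accuracy of the emulators
    (hemu : FunCalib.EmulatorCondition (X ×ˢ Θ) ν y yhat)
    -- the optimal calibration function and its identifiability
    (θstar : X → EuclideanSpace ℝ (Fin q))
    (hθstar : θstar ∈ FunCalib.nativeSpaceIn Φ P Θ)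
    (hid : FunCalib.IdentifiabilityCondition Θ ζ y θstar)
    -- the smoothing parameters
    (lam : ℕ → ℝ) (hlam_pos : ∀ n, 1 ≤ n → 0 < lam n)
    (hlam : lam =O[atTop] fun n : ℕ => (n : ℝ) ^ (-(2 * ν / (2 * ν + d))))
    (hlam_inv : (fun n => (lam n)⁻¹) =O[atTop] fun n : ℕ => (n : ℝ) ^ (2 * ν / (2 * ν + d)))
    -- the estimator, computed from the observations `ζ (x_i) + e_i`
    (θhat : ℕ → Ω → X → EuclideanSpace ℝ (Fin q))
    (hθhat : ∀ n, 1 ≤ n → ∀ᵐ ω ∂μ,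
      FunCalib.IsEstimate Φ P Θ (x n) (fun i => ζ (x n i) + e n i ω) (yhat n) (lam n)
        (θhat n ω)) :
    FunCalib.IsBigOp μ (fun n ω => FunCalib.l2NormVec fun s => θhat n ω s - θstar s)
        (fun n => (n : ℝ) ^ (-(ν / (2 * ν + d)))) ∧
      FunCalib.IsBigOp μ
        (fun n ω => ENNReal.ofReal (FunCalib.nativeNormVec Φ P (θhat n ω)))
        (fun _ => 1) :=
  theorem4_general μ d q r X hXc Θ hΘc hΘ Φ P hΦ.nonneg ζ hζ y yhat ν hν x hx σ hσ e he
    (hy.of_le (by norm_num)) hent hemu θstar hθstar hid lam hlam_pos hlam hlam_inv θhat hθhat
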